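/- Let $\mathbb K=\mathbb R,\mathbb C,\mathbb H$ with $\beta=1,2,4$ respectively, let $N\ge 1$, and let $\Psi(x)=\frac{d}{dx}\log\Gamma(x)$ be the digamma function. Write $(c)_s=\Gamma(c+s)/\Gamma(c)$ and $|\mathbf x|^2=\sum_{i=1}^N|x_i|^2$ for $\mathbf x\in\mathbb K^N$. Let $X$ be an $N\times N$ random matrix with entries in $\mathbb K$ and independent rows, the $l$-th row having, with respect to Lebesgue measure on $\mathbb K^N\cong\mathbb R^{\beta N}$, the density - (Gaussian) $(2\pi\sigma_l^2)^{-\beta N/2}e^{-|\mathbf x|^2/2\sigma_l^2}$, with all $\sigma_l>0$; or - (beta type I) $\pi^{-\beta N/2}(\beta\nu_l/2)_{\beta N/2}(1-|\mathbf x|^2)^{\beta\nu_l/2-1}$ for $|\mathbf x|<1$ and $0$ otherwise, with all $\nu_l>0$; or - (beta type II) $\pi^{-\beta N/2}(\beta\omega_l/2)_{\beta N/2}(1+|\mathbf x|^2)^{-\beta(N+\omega_l)/2}$, with all $\omega_l>0$. For quaternion entries, $|\det X|$ denotes the square root of the modulus of the determinant of the $2N\times 2N$ complex matrix obtained by replacing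 each quaternion $z+wj$ ($z,w\in\mathbb C$) by the block $\begin{bmatrix} z & w\\ -\bar w&\bar z\end{bmatrix}$. Then $\log|\det X|$ is integrable, and its mean is, for the three ensembles respectively, $$\langle\log|\det X|\rangle=\frac12\sum_{l=1}^N\Big(\log 2\sigma_l^2+\Psi\big(\beta(N-l+1)/2\big)\Big),$$ $$\langle\log|\det X|\rangle=\frac12\sum_{l=1}^N\Big(\Psi\big(\beta(N-l+1)/2\big)-\Psi\big(\beta(N+\nu_l)/2\big)\Big),$$ $$\langle\log|\det X|\rangle=\frac12\sum_{l=1}^N\Big(\Psi\big(\beta(N-l+1)/2\big)-\Psi\big(\beta\omega_l/2\big)\Big).$$ Moreover let $X_1,X_2,\dots$ be independent copies of $X$ and $P_m=X_m\cdots X_1$. For an $N\times k$ matrix $Y$ over $\mathbb K$ put $\mathrm{Vol}_k(Y)=|\det Y^\dagger Y|^{1/2}$, and define the Lyapunov exponents $\mu_1,\dots,\mu_N$ of the product by $$\mu_1+\cdots+\mu_k=\sup_Y\limsup_{m\to\infty}\frac1m\log\mathrm{Vol}_k(P_mY)\qquad(k=0,1,\dots,N),$$ the supremum being over the $N\times k$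 matrices $Y$ with (right) linearly independent columns. Then, almost surely, all $\mu_k$ are finite and $$\mu_1+\cdots+\mu_N=\langle\log|\det X|\rangle,$$ and for $k=N$ the upper limit is a limit, equal to this value, for every invertible $Y$. -/

import Mathlib

open MeasureTheory ProbabilityTheory Filter Topology
open scoped Quaternion

universe u

namespace IsotropicEnsembles

noncomputable section

/-- The digamma function of a real variable, `Ψ(x) = d/dx log Γ(x)`. -/
def digamma (x : ℝ) : ℝ := deriv (fun t : ℝ => Real.log (Real.Gamma t)) x

/-- The generalised Pochhammer symbol `(c)_s = Γ(c + s) / Γ(c)`. -/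
def pochhammer (c s : ℝ) : ℝ := Real.Gamma (c + s) / Real.Gamma c

/-! ### Measurable structure -/

/-- The Borel sigma-algebra of the quaternions.  With it, `volume` on `ℍ` is the Lebesgue measure
of the four real components (the Haar measure of the Euclidean structure). -/
instance : MeasurableSpace ℍ[ℝ] := borel ℍ[ℝ]

instance : BorelSpace ℍ[ℝ] := ⟨rfl⟩

/-- Matrices carry the product sigma-algebra of their entries. -/
instance instMeasurableSpaceMatrix {m n α : Type*} [MeasurableSpace α] :
    MeasurableSpace (Matrix m n α) :=
  inferInstanceAs (MeasurableSpace (m → n → α))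

/-! ### The three number systems -/

/-- The complex `2 × 2` block `[[z, w], [-w̄, z̄]]` of the quaternion `q = a + b i + c j + d k`,
where `z = a + i b` and `w = c + i d`. -/
def quaternionBlock (q : ℍ[ℝ]) : Matrix (Fin 2) (Fin 2) ℂ :=
  !![(⟨q.re, q.imI⟩ : ℂ), ⟨q.imJ, q.imK⟩; -star (⟨q.imJ, q.imK⟩ : ℂ), star (⟨q.re, q.imI⟩ : ℂ)]

/-- A quaternion `n × n` matrix as a complex `2n × 2n` matrix made of the above blocks. -/
def quaternionToComplex {n : ℕ} (X : Matrix (Fin n) (Fin n) ℍ[ℝ]) :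
    Matrix (Fin n × Fin 2) (Fin n × Fin 2) ℂ :=
  Matrix.of fun p q => quaternionBlock (X p.1 q.1) p.2 q.2

/-- Notation class for the modulus `|det X|` of the determinant of a square matrix.  It is only used
through its three instances, for real, complex and quaternion entries. -/
class AbsDet (𝕂 : Type) where
  absDet : {n : ℕ} → Matrix (Fin n) (Fin n) 𝕂 → ℝ

instance : AbsDet ℝ := ⟨fun X => |X.det|⟩

instance : AbsDet ℂ := ⟨fun X => ‖X.det‖⟩

/-- For quaternion entries the determinant of the associated complex matrix has modulus
`|det X| ^ 2`. -/
instance : AbsDet ℍ[ℝ] := ⟨fun X => Real.sqrt ‖(quaternionToComplex X).det‖⟩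

/-! ### Row densities and matrix ensembles

Rows are vectors `x` in `𝕂 ^ N`, and `β` is the real dimension of `𝕂`. -/

section Ensembles

variable {𝕂 : Type} {N : ℕ}

/-- `|x|² = ∑ |x_i|²`. -/
def rowNormSq [Norm 𝕂] (x : Fin N → 𝕂) : ℝ := ∑ i, ‖x i‖ ^ 2

/-- The Gaussian density `(2 π σ²)^(-βN/2) exp(-|x|² / (2 σ²))`. -/
def gaussianDensity [Norm 𝕂] (β : ℕ) (σ : ℝ) (x : Fin N → 𝕂) : ℝ :=
  (2 * Real.pi * σ ^ 2) ^ (-((β : ℝ) * N / 2)) * Real.exp (-rowNormSq x / (2 * σ ^ 2))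

/-- The beta type I density `π^(-βN/2) (βν/2)_(βN/2) (1 - |x|²)^(βν/2 - 1)` on the unit ball. -/
def betaIDensity [Norm 𝕂] (β : ℕ) (ν : ℝ) (x : Fin N → 𝕂) : ℝ :=
  open Classical in
  if rowNormSq x < 1 then
    Real.pi ^ (-((β : ℝ) * N / 2)) * pochhammer (β * ν / 2) (β * N / 2) *
      (1 - rowNormSq x) ^ ((β : ℝ) * ν / 2 - 1)
  else 0

/-- The beta type II density `π^(-βN/2) (βω/2)_(βN/2) (1 + |x|²)^(-β(N + ω)/2)`. -/
def betaIIDensity [Norm 𝕂] (β : ℕ) (ω : ℝ) (x : Fin N → 𝕂) : ℝ :=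
  Real.pi ^ (-((β : ℝ) * N / 2)) * pochhammer (β * ω / 2) (β * N / 2) *
    (1 + rowNormSq x) ^ (-((β : ℝ) * (N + ω) / 2))

/-- The law of an `N × N` random matrix with independent rows, row `l` having density `f l`
with respect to Lebesgue measure on `𝕂 ^ N`. -/
def rowEnsemble [MeasureSpace 𝕂] (f : Fin N → (Fin N → 𝕂) → ℝ) :
    Measure (Matrix (Fin N) (Fin N) 𝕂) :=
  (Measure.pi fun l : Fin N =>
    (volume : Measure (Fin N → 𝕂)).withDensity fun x => ENNReal.ofReal (f l x)).map Matrix.of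

end Ensembles

/-! ### Lyapunov exponents -/

section Lyapunov

variable {𝕂 : Type} [NormedRing 𝕂] [StarRing 𝕂] [AbsDet 𝕂] {N : ℕ}

/-- The partial products `P_m = X_m ⋯ X_1`, where `A i` is the factor `X_{i+1}`. -/
def partialProduct (A : ℕ → Matrix (Fin N) (Fin N) 𝕂) : ℕ → Matrix (Fin N) (Fin N) 𝕂
  | 0 => 1
  | m + 1 => A m * partialProduct A m

/-- The volume `|det (Y† Y)|^(1/2)` of the parallelotope generated by the columns of `Y`. -/
def parallelotopeVolume {k : ℕ} (Y : Matrix (Fin N) (Fin k) 𝕂) : ℝ :=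
  Real.sqrt (AbsDet.absDet (Y.conjTranspose * Y))

/-- Linear independence of the columns of `Y`.  The scalars multiply from the right, which matters
for quaternions, where this is the linearity that left multiplication by a matrix respects. -/
def ColumnsIndependent {k : ℕ} (Y : Matrix (Fin N) (Fin k) 𝕂) : Prop :=
  ∀ c : Fin k → 𝕂, Y.mulVec c = 0 → c = 0

/-- `(1/m) log Vol_k (P_m y_1, …, P_m y_k)`, where `y_1, …, y_k` are the columns of `Y`; the
logarithm of zero is `-∞`. -/
def volumeGrowth (A : ℕ → Matrix (Fin N) (Fin N) 𝕂) {k : ℕ} (Y : Matrix (Fin N) (Fin k) 𝕂)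
    (m : ℕ) : EReal :=
  ENNReal.log (ENNReal.ofReal (parallelotopeVolume (partialProduct A m * Y))) / (m : EReal)

/-- The sum `μ_1 + ⋯ + μ_k` of the `k` largest Lyapunov exponents: the largest exponential growth
rate of `k`-dimensional volumes under the products `P_m`. -/
def lyapunovSum (A : ℕ → Matrix (Fin N) (Fin N) 𝕂) (k : ℕ) : EReal :=
  ⨆ (Y : Matrix (Fin N) (Fin k) 𝕂) (_ : ColumnsIndependent Y), limsup (volumeGrowth A Y) atTop

/-- The Lyapunov exponent `μ_{k+1}`, `k = 0, …, N - 1`. -/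
def lyapunovExponent (A : ℕ → Matrix (Fin N) (Fin N) 𝕂) (k : Fin N) : EReal :=
  lyapunovSum A (k + 1) - lyapunovSum A k

end Lyapunov

/-! ### The two assertions about an ensemble -/

section Assertions

variable {𝕂 : Type} [AbsDet 𝕂] {N : ℕ}

/-- `⟨log |det X|⟩ = c` for `X` of law `μ`, the expectation being absolutely convergent. -/
def MeanLogDetEq [MeasurableSpace 𝕂] (μ : Measure (Matrix (Fin N) (Fin N) 𝕂)) (c : ℝ) : Prop :=
  Integrable (fun X => Real.log (AbsDet.absDet X)) μ ∧
    ∫ X, Real.log (AbsDet.absDet X) ∂μ = c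

/-- For independent `X_1, X_2, …` of law `μ`, almost surely all the Lyapunov exponents of
`P_m = X_m ⋯ X_1` are finite and their sum is `c`; moreover the growth rate of `N`-dimensional
volumes, which gives the sum of all exponents, is then an actual limit. -/
def LyapunovSumEq [NormedRing 𝕂] [StarRing 𝕂] [MeasurableSpace 𝕂]
    (μ : Measure (Matrix (Fin N) (Fin N) 𝕂)) (c : ℝ) : Prop :=
  ∀ (Ω : Type u) [MeasurableSpace Ω] (P : Measure Ω) [IsProbabilityMeasure P]
    (X : ℕ → Ω → Matrix (Fin N) (Fin N) 𝕂),
    (∀ i, HasLaw (X i) μ P) → iIndepFun X P →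
      ∀ᵐ ω ∂P,
        (∃ lyap : Fin N → ℝ, (∀ k, lyapunovExponent (fun i => X i ω) k = (lyap k : EReal)) ∧
          ∑ k, lyap k = c) ∧
        ∀ Y : Matrix (Fin N) (Fin N) 𝕂, ColumnsIndependent Y →
          Tendsto (volumeGrowth (fun i => X i ω) Y) atTop (𝓝 (c : EReal))

end Assertions

/-! ### The explicit values, with `l = 0, …, N - 1` in place of `l = 1, …, N` -/

/-- `½ ∑ (log 2σ_l² + Ψ(β(N - l + 1)/2))`. -/
def gaussianValue (β : ℕ) {N : ℕ} (σ : Fin N → ℝ) : ℝ :=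
  1 / 2 * ∑ l : Fin N, (Real.log (2 * σ l ^ 2) + digamma (β * ((N : ℝ) - (l : ℕ)) / 2))

/-- `½ ∑ (Ψ(β(N - l + 1)/2) - Ψ(β(N + ν_l)/2))`. -/
def betaIValue (β : ℕ) {N : ℕ} (ν : Fin N → ℝ) : ℝ :=
  1 / 2 * ∑ l : Fin N,
    (digamma (β * ((N : ℝ) - (l : ℕ)) / 2) - digamma (β * ((N : ℝ) + ν l) / 2))

/-- `½ ∑ (Ψ(β(N - l + 1)/2) - Ψ(βω_l/2))`. -/
def betaIIValue (β : ℕ) {N : ℕ} (ω : Fin N → ℝ) : ℝ :=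
  1 / 2 * ∑ l : Fin N, (digamma (β * ((N : ℝ) - (l : ℕ)) / 2) - digamma (β * ω l / 2))

/-- Both assertions, about an ensemble and a value. -/
def LogDetFormula {𝕂 : Type} [NormedRing 𝕂] [StarRing 𝕂] [MeasureSpace 𝕂] [AbsDet 𝕂] {N : ℕ}
    (f : Fin N → (Fin N → 𝕂) → ℝ) (c : ℝ) : Prop :=
  MeanLogDetEq (rowEnsemble f) c ∧ LyapunovSumEq.{u} (rowEnsemble f) c

end

end IsotropicEnsembles

open IsotropicEnsembles

/-!
The determinant and the Lyapunov exponents of a matrix with independent isotropic rows.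

The means of logarithms come from moments: when `E T ^ s = φ s` for all `s` near `0`, including
negative ones, then `T > 0` almost surely, `log T` is integrable, and its mean is `φ' 0`
(`mean_log_of_moments`).

The moments of `|det X|²` factorise (`lintegral_absDet_sq_rpow`).  For a fixed first row, a
Householder reflection acting from the right takes this row to a multiple of the first basis vector
and leaves the joint law of the other rows unchanged, since they are isotropic.  Expansion along the
first row gives its length times a determinant of size `N - 1`, the rows of which are the remaining
rows without their first coordinates, and are again isotropic.  By induction `E |det X| ^ (2 s)` is
the product over `l = 0, …, N - 1` of the moments of `∑_{i ≥ l} |x_i|²`, where `x` is the `l`-th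
row.  In polar coordinates such a moment is the Mellin transform of the radial density times a
factor which does not depend on the density; the Gaussian density identifies this factor as a
quotient of values of the Gamma function (`lintegral_tailNormSq_mul_radial`).  For the three
ensembles the Mellin transforms are Gamma and beta integrals, and their logarithmic derivatives are
values of the digamma function.

The volume of the image of all of `𝕂 ^ N` is multiplicative, so that the strong law of large numbers
gives the limit for `k = N`.  For `k < N` only finiteness is needed: it follows from the strong law
for a bound of `log ‖X‖` and `log ‖X⁻¹‖` by `log (1 + |x_l|²)` and `|log |det X||`
(`norm_toComplex_le_exp_logNormBound`).  The sum of all exponents then telescopes.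

The three number systems are treated together by means of a representation by complex matrices
(`ComplexRep`), in which `|det X|` is a power of the modulus of a complex determinant.
-/

namespace IsotropicEnsembles

/-! ### Logarithmic means from moments -/

/-- The function `φ` is the moment generating function of `log T`.  A finite moment of negative order
excludes `T = 0`, where `log T` would be a junk value. -/
theorem mean_log_of_moments {Ω : Type*} [MeasurableSpace Ω] {ν : Measure Ω} {T : Ω → ℝ}
    (hT : Measurable T) {φ : ℝ → ℝ} {c : ℝ} (hφ : HasDerivAt φ c 0)
    (h0 : φ 0 = 1)
    (hm : ∀ᶠ s in 𝓝 (0 : ℝ), ∫⁻ x, ENNReal.ofReal (T x) ^ s ∂ν = ENNReal.ofReal (φ s)) :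
    IsProbabilityMeasure ν ∧ (∀ᵐ x ∂ν, 0 < T x) ∧ Integrable (fun x => Real.log (T x)) ν ∧
      ∫ x, Real.log (T x) ∂ν = c := by
  have hprob : IsProbabilityMeasure ν := by
    have := hm.self_of_nhds
    simp only [ENNReal.rpow_zero, lintegral_const, one_mul, h0, ENNReal.ofReal_one] at this
    exact ⟨this⟩
  have hpos : ∀ᵐ x ∂ν, 0 < T x := by
    obtain ⟨s, hs, hs0⟩ :=
      ((hm.filter_mono nhdsWithin_le_nhds).and (self_mem_nhdsWithin : Set.Iio (0 : ℝ) ∈ 𝓝[<] 0)).exists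
    have hfin : ∫⁻ x, ENNReal.ofReal (T x) ^ s ∂ν ≠ ⊤ := by rw [hs]; exact ENNReal.ofReal_ne_top
    filter_upwards [ae_lt_top (hT.ennreal_ofReal.pow_const s) hfin] with x hx
    by_contra hn
    rw [ENNReal.ofReal_of_nonpos (not_lt.1 hn), ENNReal.zero_rpow_of_neg hs0] at hx
    exact lt_irrefl _ hx
  have hmeas : Measurable fun x => Real.log (T x) := hT.log
  have hexp : ∀ s : ℝ, ∀ᵐ x ∂ν,
      ENNReal.ofReal (Real.exp (s * Real.log (T x))) = ENNReal.ofReal (T x) ^ s := by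
    intro s
    filter_upwards [hpos] with x hx
    rw [ENNReal.ofReal_rpow_of_pos hx, Real.rpow_def_of_pos hx, mul_comm]
  have hint : ∀ᶠ s in 𝓝 (0 : ℝ), Integrable (fun x => Real.exp (s * Real.log (T x))) ν := by
    filter_upwards [hm] with s hs
    refine ⟨(by fun_prop : Measurable _).aestronglyMeasurable, ?_⟩
    rw [hasFiniteIntegral_iff_ofReal (ae_of_all _ fun x => (Real.exp_pos _).le),
      lintegral_congr_ae (hexp s), hs]
    exact ENNReal.ofReal_lt_top
  have hφpos : ∀ᶠ s in 𝓝 (0 : ℝ), 0 < φ s :=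
    hφ.continuousAt.eventually_const_lt (by rw [h0]; exact one_pos)
  have hmgf : mgf (fun x => Real.log (T x)) ν =ᶠ[𝓝 0] φ := by
    filter_upwards [hm, hφpos] with s hs hp
    rw [mgf, integral_eq_lintegral_of_nonneg_ae (ae_of_all _ fun x => (Real.exp_pos _).le)
      (by fun_prop : Measurable _).aestronglyMeasurable, lintegral_congr_ae (hexp s), hs,
      ENNReal.toReal_ofReal hp.le]
  have hint0 : (0 : ℝ) ∈ interior (integrableExpSet (fun x => Real.log (T x)) ν) :=
    mem_interior_iff_mem_nhds.2 hint
  refine ⟨hprob, hpos, ?_, ?_⟩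
  · simpa using integrable_pow_mul_exp_of_mem_interior_integrableExpSet hint0 1
  · have h1 := hasDerivAt_mgf hint0
    have h2 := (hφ.congr_of_eventuallyEq hmgf).unique h1
    simpa using h2.symm

/-- The left side is the moment generating function of the logarithm of a Gamma variable with shape
parameter `c`. -/
theorem hasDerivAt_Gamma_ratio {c : ℝ} (hc : 0 < c) :
    HasDerivAt (fun s => Real.Gamma (c + s) / Real.Gamma c) (digamma c) 0 := by
  have hd : DifferentiableAt ℝ Real.Gamma c :=
    Real.differentiableAt_Gamma fun m => by
      have : (0 : ℝ) ≤ m := Nat.cast_nonneg m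
      linarith
  have hG := Real.Gamma_pos_of_pos hc
  have h1 : HasDerivAt (fun s => Real.Gamma (c + s)) (deriv Real.Gamma c) 0 := by
    have := hd.hasDerivAt
    rw [← add_zero c] at this
    simpa using this.comp_const_add c 0
  have h2 : digamma c = deriv Real.Gamma c / Real.Gamma c :=
    (hd.hasDerivAt.log hG.ne').deriv
  rw [h2]
  exact h1.div_const _

theorem hasDerivAt_Gamma_ratio_neg {c : ℝ} (hc : 0 < c) :
    HasDerivAt (fun s => Real.Gamma (c - s) / Real.Gamma c) (-digamma c) 0 := by
  have h := hasDerivAt_Gamma_ratio hc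
  rw [← neg_zero] at h
  have h2 := HasDerivAt.scomp (0 : ℝ) h (hasDerivAt_neg (0 : ℝ))
  rw [neg_one_smul] at h2
  exact h2.congr_of_eventuallyEq (Eventually.of_forall fun s => by simp [sub_eq_add_neg])

theorem hasDerivAt_Gamma_ratio_inv {c : ℝ} (hc : 0 < c) :
    HasDerivAt (fun s => Real.Gamma c / Real.Gamma (c + s)) (-digamma c) 0 := by
  have h := (hasDerivAt_Gamma_ratio hc).inv (by simp [(Real.Gamma_pos_of_pos hc).ne'])
  simp only [add_zero, div_self (Real.Gamma_pos_of_pos hc).ne', one_pow, div_one] at h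
  exact h.congr_of_eventuallyEq (Eventually.of_forall fun s => by simp)

/-! ### One-dimensional Mellin transforms -/

/-- The Mellin transform at `a` of a nonnegative function, with values in `[0, ∞]`. -/
noncomputable def lmellin (F : ℝ → ENNReal) (a : ℝ) : ENNReal :=
  ∫⁻ t in Set.Ioi (0 : ℝ), ENNReal.ofReal (t ^ (a - 1)) * F t

theorem lmellin_const_mul {F : ℝ → ENNReal} (hF : Measurable F) (c : ENNReal) (a : ℝ) :
    lmellin (fun t => c * F t) a = c * lmellin F a := by
  rw [lmellin, lmellin, ← lintegral_const_mul c (by fun_prop)]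
  exact lintegral_congr fun t => by ring

theorem lmellin_exp {a b : ℝ} (ha : 0 < a) (hb : 0 < b) :
    lmellin (fun t => ENNReal.ofReal (Real.exp (-(b * t)))) a =
      ENNReal.ofReal (b ^ (-a) * Real.Gamma a) := by
  have h := Real.integral_rpow_mul_exp_neg_mul_Ioi ha hb
  rw [one_div, Real.inv_rpow hb.le, ← Real.rpow_neg hb.le] at h
  have hne : ∫ t in Set.Ioi (0 : ℝ), t ^ (a - 1) * Real.exp (-(b * t)) ≠ 0 := by
    rw [h]
    exact (mul_pos (Real.rpow_pos_of_pos hb _) (Real.Gamma_pos_of_pos ha)).ne'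
  rw [← h, ofReal_integral_eq_lintegral_ofReal (Integrable.of_integral_ne_zero hne)
    ((ae_restrict_mem measurableSet_Ioi).mono fun t (ht : 0 < t) => by
      positivity), lmellin]
  refine setLIntegral_congr_fun measurableSet_Ioi fun t (ht : 0 < t) => ?_
  rw [ENNReal.ofReal_mul (by positivity)]

theorem lmellin_betaI {a b : ℝ} (ha : 0 < a) (hb : 0 < b) :
    lmellin (fun t => ENNReal.ofReal (open Classical in if t < 1 then (1 - t) ^ (b - 1) else 0)) a =
      ENNReal.ofReal (Real.Gamma a * Real.Gamma b / Real.Gamma (a + b)) := by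
  have hB : 0 < beta a b := beta_pos ha hb
  have h := lintegral_betaPDF_eq_one ha hb
  rw [lintegral_betaPDF] at h
  change _ = ENNReal.ofReal (beta a b)
  have h2 : lmellin (fun t => ENNReal.ofReal
      (open Classical in if t < 1 then (1 - t) ^ (b - 1) else 0)) a =
      ENNReal.ofReal (beta a b) * ∫⁻ (x : ℝ) in Set.Ioo 0 1,
        ENNReal.ofReal (1 / beta a b * x ^ (a - 1) * (1 - x) ^ (b - 1)) := by
    rw [lmellin, ← lintegral_const_mul _ (by fun_prop), ← Set.Iio_inter_Ioi,
      ← Measure.restrict_restrict measurableSet_Iio, ← lintegral_indicator measurableSet_Iio]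
    refine setLIntegral_congr_fun measurableSet_Ioi fun t (ht : 0 < t) => ?_
    by_cases h1 : t < 1
    · have h1' : 0 < 1 - t := by linarith
      simp only [h1, if_true, Set.indicator, Set.mem_Iio]
      rw [← ENNReal.ofReal_mul (by positivity), ← ENNReal.ofReal_mul hB.le]
      congr 1
      field_simp
    · simp [h1, Set.indicator]
  rw [h2, h, mul_one]

theorem lmellin_betaII {a b : ℝ} (ha : 0 < a) (hb : 0 < b) :
    lmellin (fun t => ENNReal.ofReal ((1 + t) ^ (-(a + b)))) a =
      ENNReal.ofReal (Real.Gamma a * Real.Gamma b / Real.Gamma (a + b)) := by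
  have hab : 0 < a + b := add_pos ha hb
  have hG := Real.Gamma_pos_of_pos hab
  -- `Γ(a + b) (1 + t)^(-(a + b))` is itself a Mellin transform of an exponential.
  have h1 : ENNReal.ofReal (Real.Gamma (a + b)) *
      lmellin (fun t => ENNReal.ofReal ((1 + t) ^ (-(a + b)))) a =
      ∫⁻ t in Set.Ioi (0 : ℝ), ∫⁻ y in Set.Ioi (0 : ℝ), ENNReal.ofReal (t ^ (a - 1)) *
        (ENNReal.ofReal (y ^ (a + b - 1)) * ENNReal.ofReal (Real.exp (-((1 + t) * y)))) := by
    rw [lmellin, ← lintegral_const_mul _ (by fun_prop)]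
    refine setLIntegral_congr_fun measurableSet_Ioi fun t (ht : 0 < t) => ?_
    rw [lintegral_const_mul _ (by fun_prop)]
    have := lmellin_exp hab (by linarith : 0 < 1 + t)
    rw [lmellin] at this
    rw [this, ENNReal.ofReal_mul (by positivity)]
    ring
  have h2 : ENNReal.ofReal (Real.Gamma (a + b)) *
      lmellin (fun t => ENNReal.ofReal ((1 + t) ^ (-(a + b)))) a =
      ENNReal.ofReal (Real.Gamma a) * ENNReal.ofReal (Real.Gamma b) := by
    rw [h1, lintegral_lintegral_swap (by fun_prop)]
    have := lmellin_exp hb one_pos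
    simp only [Real.one_rpow, one_mul, lmellin] at this
    rw [← this, ← lintegral_const_mul _ (by fun_prop)]
    refine setLIntegral_congr_fun measurableSet_Ioi fun y (hy : 0 < y) => ?_
    have hy2 := lmellin_exp ha hy
    rw [lmellin] at hy2
    have e : ∀ t ∈ Set.Ioi (0 : ℝ), ENNReal.ofReal (t ^ (a - 1)) *
        (ENNReal.ofReal (y ^ (a + b - 1)) * ENNReal.ofReal (Real.exp (-((1 + t) * y)))) =
        ENNReal.ofReal (y ^ (a + b - 1) * Real.exp (-y)) *
          (ENNReal.ofReal (t ^ (a - 1)) * ENNReal.ofReal (Real.exp (-(y * t)))) := by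
      intro t ht
      have ht : 0 < t := ht
      rw [show -((1 + t) * y) = -y + -(y * t) by ring, Real.exp_add,
        ENNReal.ofReal_mul (Real.exp_pos _).le, ENNReal.ofReal_mul (by positivity)]
      ring
    rw [setLIntegral_congr_fun measurableSet_Ioi e, lintegral_const_mul _ (by fun_prop), hy2,
      ← ENNReal.ofReal_mul (by positivity),
      ← ENNReal.ofReal_mul (by positivity), ← ENNReal.ofReal_mul (Real.Gamma_pos_of_pos ha).le]
    congr 1
    have : y ^ (a + b - 1) * y ^ (-a) = y ^ (b - 1) := by
      rw [← Real.rpow_add hy]; congr 1; ring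
    rw [← this]; ring
  rw [div_eq_inv_mul, ENNReal.ofReal_mul (by positivity),
    ENNReal.ofReal_mul (Real.Gamma_pos_of_pos ha).le, ← h2, ← mul_assoc,
    ← ENNReal.ofReal_mul (by positivity), inv_mul_cancel₀ hG.ne', ENNReal.ofReal_one, one_mul]

/-! ### Radial integrals -/

theorem lmellin_eq_radial {F : ℝ → ENNReal} {a : ℝ} :
    lmellin F a = 2 * ∫⁻ r in Set.Ioi (0 : ℝ), ENNReal.ofReal (r ^ (2 * a - 1)) * F (r ^ 2) := by
  have himg : (fun r : ℝ => r ^ 2) '' Set.Ioi 0 = Set.Ioi 0 := by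
    ext t
    constructor
    · rintro ⟨r, hr, rfl⟩
      exact pow_pos (Set.mem_Ioi.1 hr) 2
    · intro ht
      exact ⟨Real.sqrt t, Real.sqrt_pos.2 ht, Real.sq_sqrt (le_of_lt ht)⟩
  have h := lintegral_image_eq_lintegral_abs_deriv_mul (s := Set.Ioi (0 : ℝ))
    (f := fun r => r ^ 2) (f' := fun r => 2 * r) measurableSet_Ioi
    (fun x _ => by simpa using (hasDerivAt_pow 2 x).hasDerivWithinAt)
    (fun x hx y hy hxy => (pow_left_inj₀ (le_of_lt hx) (le_of_lt hy) two_ne_zero).1 hxy)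
    (fun t => ENNReal.ofReal (t ^ (a - 1)) * F t)
  rw [himg] at h
  rw [lmellin, h, ← lintegral_const_mul' _ _ (by norm_num)]
  refine setLIntegral_congr_fun measurableSet_Ioi fun r (hr : 0 < r) => ?_
  rw [← mul_assoc, ← mul_assoc, ← ENNReal.ofReal_mul (by positivity)]
  congr 1
  rw [show (2 : ENNReal) = ENNReal.ofReal 2 by simp, ← ENNReal.ofReal_mul (by positivity)]
  congr 1
  rw [abs_of_pos (by positivity), mul_assoc]
  congr 1
  rw [← Real.rpow_natCast, ← Real.rpow_mul hr.le]
  nth_rw 1 [← Real.rpow_one r]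
  rw [← Real.rpow_add hr]
  congr 1
  push_cast
  ring

/-- Polar coordinates: the integral of a homogeneous function of degree `2 s` times a radial
function is a Mellin transform of the radial function, up to a factor which does not depend on it. -/
theorem exists_lintegral_homogeneous_mul_radial {E : Type*} [NormedAddCommGroup E]
    [NormedSpace ℝ E] [FiniteDimensional ℝ E] [Nontrivial E] [MeasurableSpace E] [BorelSpace E]
    (μ : Measure E) [μ.IsAddHaarMeasure] {T : E → ENNReal} (hT : Measurable T) (s : ℝ)
    (hs : ∀ (r : ℝ), 0 < r → ∀ x, T (r • x) = ENNReal.ofReal (r ^ 2) ^ s * T x) :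
    ∃ K : ENNReal, ∀ F : ℝ → ENNReal, Measurable F →
      ∫⁻ x, T x * F (‖x‖ ^ 2) ∂μ = K * lmellin F ((Module.finrank ℝ E : ℝ) / 2 + s) := by
  refine ⟨(∫⁻ u : Metric.sphere (0 : E) 1, T u ∂μ.toSphere) * 2⁻¹, fun F hF => ?_⟩
  have hpos : 0 < Module.finrank ℝ E := Module.finrank_pos
  have h1 : ∫⁻ x, T x * F (‖x‖ ^ 2) ∂μ =
      ∫⁻ y : ({0}ᶜ : Set E), T y * F (‖(y : E)‖ ^ 2) ∂(μ.comap (↑)) := by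
    rw [lintegral_subtype_comap (measurableSet_singleton _).compl
      (fun x => T x * F (‖x‖ ^ 2)), restrict_compl_singleton]
  have h2 : ∫⁻ y : ({0}ᶜ : Set E), T y * F (‖(y : E)‖ ^ 2) ∂(μ.comap (↑)) =
      ∫⁻ p : Metric.sphere (0 : E) 1 × Set.Ioi (0 : ℝ),
        T p.1 * (ENNReal.ofReal ((p.2 : ℝ) ^ 2) ^ s * F ((p.2 : ℝ) ^ 2))
          ∂(μ.toSphere.prod (Measure.volumeIoiPow (Module.finrank ℝ E - 1))) := by
    rw [← μ.measurePreserving_homeomorphUnitSphereProd.lintegral_comp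
      (by fun_prop)]
    refine lintegral_congr fun y => ?_
    have hy : 0 < ‖(y : E)‖ := norm_pos_iff.2 y.2
    rw [homeomorphUnitSphereProd_apply_fst_coe, homeomorphUnitSphereProd_apply_snd_coe, ← mul_assoc,
      mul_comm (T _) (_ ^ s), ← hs _ hy, smul_smul, mul_inv_cancel₀ hy.ne', one_smul]
  rw [h1, h2, lintegral_prod_mul (f := fun u : Metric.sphere (0 : E) 1 => T u)
    (g := fun r : Set.Ioi (0 : ℝ) => ENNReal.ofReal ((r : ℝ) ^ 2) ^ s * F ((r : ℝ) ^ 2))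
    (by fun_prop) (by fun_prop), mul_assoc]
  congr 1
  rw [Measure.volumeIoiPow, lintegral_withDensity_eq_lintegral_mul _ (by fun_prop) (by fun_prop)]
  simp only [Pi.mul_apply]
  rw [lintegral_subtype_comap measurableSet_Ioi (fun r : ℝ =>
    ENNReal.ofReal (r ^ (Module.finrank ℝ E - 1)) * (ENNReal.ofReal (r ^ 2) ^ s * F (r ^ 2))),
    lmellin_eq_radial, ← mul_assoc, ENNReal.inv_mul_cancel (by norm_num) (by norm_num), one_mul]
  refine setLIntegral_congr_fun measurableSet_Ioi fun r (hr : 0 < r) => ?_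
  rw [← mul_assoc, ENNReal.ofReal_rpow_of_pos (by positivity), ← ENNReal.ofReal_mul (by positivity)]
  congr 2
  rw [← Real.rpow_natCast, ← Real.rpow_natCast r 2, ← Real.rpow_mul hr.le, ← Real.rpow_add hr,
    Nat.cast_sub hpos]
  congr 1
  push_cast
  ring

section Rows

variable {V : Type} [NormedAddCommGroup V]

/-- The squared norm of the vector of the coordinates `x i` with `k ≤ i`. -/
noncomputable def tailNormSq {n : ℕ} (k : ℕ) (x : Fin n → V) : ℝ :=
  ∑ i : Fin n, if k ≤ (i : ℕ) then ‖x i‖ ^ 2 else 0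

theorem tailNormSq_zero {n : ℕ} (x : Fin n → V) : tailNormSq 0 x = rowNormSq x := by
  simp [tailNormSq, rowNormSq]

theorem rowNormSq_nonneg {n : ℕ} (x : Fin n → V) : 0 ≤ rowNormSq x :=
  Finset.sum_nonneg fun i _ => by positivity

theorem tailNormSq_succ {n : ℕ} (k : ℕ) (x : Fin (n + 1) → V) :
    tailNormSq (k + 1) x = tailNormSq k (Fin.tail x) := by
  simp [tailNormSq, Fin.sum_univ_succ, Fin.tail]

theorem rowNormSq_succ {n : ℕ} (x : Fin (n + 1) → V) :
    rowNormSq x = ‖x 0‖ ^ 2 + rowNormSq (Fin.tail x) := by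
  simp [rowNormSq, Fin.sum_univ_succ, Fin.tail]

theorem continuous_rowNormSq {n : ℕ} : Continuous (rowNormSq : (Fin n → V) → ℝ) := by
  unfold rowNormSq
  fun_prop

theorem rowNormSq_eq_zero {n : ℕ} {x : Fin n → V} : rowNormSq x = 0 ↔ x = 0 := by
  rw [rowNormSq, Finset.sum_eq_zero_iff_of_nonneg fun i _ => by positivity]
  simp [funext_iff]

theorem continuous_tailNormSq {n : ℕ} (k : ℕ) :
    Continuous (tailNormSq k : (Fin n → V) → ℝ) := by
  unfold tailNormSq
  refine continuous_finsetSum _ fun i _ => ?_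
  split_ifs <;> fun_prop

variable [NormedSpace ℝ V]

theorem tailNormSq_smul {n : ℕ} (k : ℕ) (r : ℝ) (x : Fin n → V) :
    tailNormSq k (r • x) = r ^ 2 * tailNormSq k x := by
  rw [tailNormSq, tailNormSq, Finset.mul_sum]
  refine Finset.sum_congr rfl fun i _ => ?_
  split_ifs <;> simp [norm_smul, mul_pow]

variable [FiniteDimensional ℝ V] [MeasureSpace V] [BorelSpace V]

@[fun_prop]
theorem measurable_rowNormSq {n : ℕ} : Measurable (rowNormSq : (Fin n → V) → ℝ) := by
  have := FiniteDimensional.proper_real V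
  have : SecondCountableTopology V := secondCountable_of_proper
  exact continuous_rowNormSq.measurable

@[fun_prop]
theorem measurable_tailNormSq {n : ℕ} (k : ℕ) : Measurable (tailNormSq k : (Fin n → V) → ℝ) := by
  have := FiniteDimensional.proper_real V
  have : SecondCountableTopology V := secondCountable_of_proper
  exact (continuous_tailNormSq k).measurable

variable [(volume : Measure V).IsAddHaarMeasure]

/-- The sup norm of `Fin n → V` is replaced by the Euclidean one to apply
`exists_lintegral_homogeneous_mul_radial`. -/
theorem exists_lintegral_tailNormSq_mul_radial [Nontrivial V] {n : ℕ} (hn : 0 < n) (k : ℕ) (s : ℝ) :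
    ∃ K : ENNReal, ∀ F : ℝ → ENNReal, Measurable F →
      ∫⁻ x : Fin n → V, ENNReal.ofReal (tailNormSq k x) ^ s * F (rowNormSq x) =
        K * lmellin F ((Module.finrank ℝ V : ℝ) * n / 2 + s) := by
  have hproper : ProperSpace V := FiniteDimensional.proper_real V
  have : SecondCountableTopology V := secondCountable_of_proper
  have : Nonempty (Fin n) := ⟨⟨0, hn⟩⟩
  -- The Euclidean norm on rows.
  let e : (Fin n → V) ≃L[ℝ] PiLp 2 (fun _ : Fin n => V) :=
    (PiLp.continuousLinearEquiv 2 ℝ (fun _ : Fin n => V)).symm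
  let μ : Measure (PiLp 2 (fun _ : Fin n => V)) := (volume : Measure (Fin n → V)).map e
  have hμ : μ.IsAddHaarMeasure := ContinuousLinearEquiv.isAddHaarMeasure_map e volume
  have hnt : Nontrivial (PiLp 2 (fun _ : Fin n => V)) := e.symm.toEquiv.nontrivial
  have hdim : Module.finrank ℝ (PiLp 2 (fun _ : Fin n => V)) = Module.finrank ℝ V * n := by
    rw [← e.toLinearEquiv.finrank_eq, Module.finrank_pi_fintype]
    simp [mul_comm]
  have he : Measurable e := e.continuous.measurable
  have hsymm : Measurable e.symm := e.symm.continuous.measurable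
  obtain ⟨K, hK⟩ := exists_lintegral_homogeneous_mul_radial μ
    (T := fun x => ENNReal.ofReal (tailNormSq k (e.symm x)) ^ s)
    (((measurable_tailNormSq k).comp hsymm).ennreal_ofReal.pow_const s) s (fun r hr x => by
      rw [map_smul, tailNormSq_smul, ENNReal.ofReal_mul (by positivity),
        ENNReal.mul_rpow_of_ne_top ENNReal.ofReal_ne_top ENNReal.ofReal_ne_top])
  refine ⟨K, fun F hF => ?_⟩
  have := hK F hF
  rw [hdim, lintegral_map (by fun_prop) he] at this
  push_cast at this
  rw [← this]
  refine lintegral_congr fun x => ?_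
  have hn : ‖e x‖ ^ 2 = rowNormSq x := by
    rw [PiLp.norm_sq_eq_of_L2]
    rfl
  rw [hn, e.symm_apply_apply]

end Rows

theorem lintegral_pi_succ {α : Type*} [MeasurableSpace α] {n : ℕ} (μ : Fin (n + 1) → Measure α)
    [∀ i, SigmaFinite (μ i)] {g : (Fin (n + 1) → α) → ENNReal} (hg : Measurable g) :
    ∫⁻ x, g x ∂Measure.pi μ =
      ∫⁻ a, ∫⁻ y, g (Fin.cons a y) ∂(Measure.pi fun j => μ j.succ) ∂(μ 0) := by
  have hmp := measurePreserving_piFinSuccAbove μ 0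
  have h := (hmp.symm _).lintegral_comp hg
  rw [← h, lintegral_prod _ (by fun_prop)]
  refine lintegral_congr fun a => lintegral_congr fun y => ?_
  congr 1
  exact Fin.insertNth_zero' a y

/-- The volume of a real normed space is normalised so that `exp (-|v|²)` has the integral
`π ^ (dim / 2)`, as it has for the Lebesgue measure of a Euclidean space. -/
class GaussianVolume (V : Type) [NormedAddCommGroup V] [NormedSpace ℝ V] [MeasureSpace V] :
    Prop where
  lintegral_exp : ∫⁻ v : V, ENNReal.ofReal (Real.exp (-‖v‖ ^ 2)) =
    ENNReal.ofReal (Real.pi ^ ((Module.finrank ℝ V : ℝ) / 2))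

section Rows

variable {V : Type} [NormedAddCommGroup V] [NormedSpace ℝ V] [FiniteDimensional ℝ V]
  [Nontrivial V] [MeasureSpace V] [BorelSpace V] [(volume : Measure V).IsAddHaarMeasure]
  [GaussianVolume V]

omit [Nontrivial V] in
theorem lintegral_exp_neg_rowNormSq (n : ℕ) :
    ∫⁻ x : Fin n → V, ENNReal.ofReal (Real.exp (-rowNormSq x)) =
      ENNReal.ofReal (Real.pi ^ ((Module.finrank ℝ V : ℝ) * n / 2)) := by
  have := FiniteDimensional.proper_real V
  induction n with
  | zero => simp [rowNormSq, volume_pi]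
  | succ n ih =>
    rw [volume_pi, lintegral_pi_succ _ (by fun_prop)]
    have : ∀ (a : V) (y : Fin n → V),
        ENNReal.ofReal (Real.exp (-rowNormSq (Fin.cons a y : Fin (n + 1) → V))) =
        ENNReal.ofReal (Real.exp (-‖a‖ ^ 2)) * ENNReal.ofReal (Real.exp (-rowNormSq y)) := by
      intro a y
      rw [rowNormSq_succ, Fin.tail_cons, Fin.cons_zero, neg_add, Real.exp_add,
        ENNReal.ofReal_mul (Real.exp_pos _).le]
    simp_rw [this]
    rw [← volume_pi]
    simp_rw [lintegral_const_mul' _ _ ENNReal.ofReal_ne_top]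
    rw [ih, lintegral_mul_const' _ _ ENNReal.ofReal_ne_top, GaussianVolume.lintegral_exp,
      ← ENNReal.ofReal_mul (by positivity), ← Real.rpow_add Real.pi_pos]
    congr 2
    push_cast
    ring

theorem lintegral_radial {n : ℕ} (hn : 0 < n) {F : ℝ → ENNReal} (hF : Measurable F) :
    ∫⁻ x : Fin n → V, F (rowNormSq x) =
      ENNReal.ofReal (Real.pi ^ ((Module.finrank ℝ V : ℝ) * n / 2) /
        Real.Gamma ((Module.finrank ℝ V : ℝ) * n / 2)) *
        lmellin F ((Module.finrank ℝ V : ℝ) * n / 2) := by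
  obtain ⟨K, hK⟩ := exists_lintegral_tailNormSq_mul_radial (V := V) hn 0 0
  simp only [ENNReal.rpow_zero, one_mul, add_zero] at hK
  have hβ : (0 : ℝ) < Module.finrank ℝ V := by exact_mod_cast Module.finrank_pos
  have hn' : (0 : ℝ) < n := by exact_mod_cast hn
  set a := (Module.finrank ℝ V : ℝ) * n / 2 with ha
  have hapos : 0 < a := by positivity
  have hG := Real.Gamma_pos_of_pos hapos
  -- The constant is found from the Gaussian function.
  have h := hK (fun t => ENNReal.ofReal (Real.exp (-(1 * t)))) (by fun_prop)
  rw [lmellin_exp hapos one_pos] at h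
  simp only [one_mul, Real.one_rpow] at h
  rw [lintegral_exp_neg_rowNormSq, ← ha] at h
  rw [hK F hF, ENNReal.ofReal_div_of_pos hG, h, ENNReal.mul_div_cancel_right
    (by simpa using hG) ENNReal.ofReal_ne_top]

/-- Under the Gaussian weight the coordinates are independent, so those with index below `k`
integrate out one by one and leave the case `k = 0` in dimension `n - k`. -/
theorem lintegral_tailNormSq_mul_exp {n k : ℕ} (hk : k < n) {s : ℝ}
    (hs : 0 < (Module.finrank ℝ V : ℝ) * ((n : ℝ) - k) / 2 + s) :
    ∫⁻ x : Fin n → V, ENNReal.ofReal (tailNormSq k x) ^ s *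
        ENNReal.ofReal (Real.exp (-rowNormSq x)) =
      ENNReal.ofReal (Real.pi ^ ((Module.finrank ℝ V : ℝ) * n / 2) *
        (Real.Gamma ((Module.finrank ℝ V : ℝ) * ((n : ℝ) - k) / 2 + s) /
          Real.Gamma ((Module.finrank ℝ V : ℝ) * ((n : ℝ) - k) / 2))) := by
  have := FiniteDimensional.proper_real V
  have hβ : (0 : ℝ) < Module.finrank ℝ V := by exact_mod_cast Module.finrank_pos
  induction n generalizing k with
  | zero => omega
  | succ n ih =>
    cases k with
    | zero =>
      simp only [tailNormSq_zero, Nat.cast_zero, sub_zero] at hs ⊢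
      have hpos : 0 < (Module.finrank ℝ V : ℝ) * ((n + 1 : ℕ) : ℝ) / 2 := by positivity
      set a := (Module.finrank ℝ V : ℝ) * ((n + 1 : ℕ) : ℝ) / 2 with ha
      have hG := Real.Gamma_pos_of_pos hpos
      rw [lintegral_radial (V := V) (Nat.succ_pos n)
        (F := fun t => ENNReal.ofReal t ^ s * ENNReal.ofReal (Real.exp (-t))) (by fun_prop), ← ha]
      have h := lmellin_exp hs one_pos
      simp only [Real.one_rpow, one_mul] at h
      have h2 : lmellin (fun t => ENNReal.ofReal t ^ s * ENNReal.ofReal (Real.exp (-t))) a =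
          ENNReal.ofReal (Real.Gamma (a + s)) := by
        rw [← h, lmellin, lmellin]
        refine setLIntegral_congr_fun measurableSet_Ioi fun t (ht : 0 < t) => ?_
        rw [← mul_assoc, ENNReal.ofReal_rpow_of_pos ht, ← ENNReal.ofReal_mul (by positivity),
          ← Real.rpow_add ht]
        congr 3
        ring
      rw [h2, ← ENNReal.ofReal_mul (by positivity)]
      congr 1
      ring
    | succ k =>
      have e : ((n + 1 : ℕ) : ℝ) - ((k + 1 : ℕ) : ℝ) = (n : ℝ) - k := by push_cast; ring
      rw [e] at hs ⊢
      rw [volume_pi, lintegral_pi_succ _ (by fun_prop)]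
      have : ∀ (a : V) (y : Fin n → V),
          ENNReal.ofReal (tailNormSq (k + 1) (Fin.cons a y : Fin (n + 1) → V)) ^ s *
          ENNReal.ofReal (Real.exp (-rowNormSq (Fin.cons a y : Fin (n + 1) → V))) =
          ENNReal.ofReal (Real.exp (-‖a‖ ^ 2)) *
            (ENNReal.ofReal (tailNormSq k y) ^ s * ENNReal.ofReal (Real.exp (-rowNormSq y))) := by
        intro a y
        rw [rowNormSq_succ, tailNormSq_succ, Fin.tail_cons, Fin.cons_zero, neg_add, Real.exp_add,
          ENNReal.ofReal_mul (Real.exp_pos _).le]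
        ring
      simp_rw [this]
      rw [← volume_pi]
      simp_rw [lintegral_const_mul' _ _ ENNReal.ofReal_ne_top]
      rw [ih (by omega) hs, lintegral_mul_const' _ _ ENNReal.ofReal_ne_top,
        GaussianVolume.lintegral_exp,
        ← ENNReal.ofReal_mul (by positivity), ← mul_assoc, ← Real.rpow_add Real.pi_pos]
      congr 3
      push_cast
      ring

/-- The factor in front of the Mellin transform, which is the same for all `F`, is read off from the
Gaussian function. -/
theorem lintegral_tailNormSq_mul_radial {n k : ℕ} (hk : k < n) {s : ℝ}
    (hs : 0 < (Module.finrank ℝ V : ℝ) * ((n : ℝ) - k) / 2 + s)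
    {F : ℝ → ENNReal} (hF : Measurable F) :
    ∫⁻ x : Fin n → V, ENNReal.ofReal (tailNormSq k x) ^ s * F (rowNormSq x) =
      ENNReal.ofReal (Real.pi ^ ((Module.finrank ℝ V : ℝ) * n / 2) *
        (Real.Gamma ((Module.finrank ℝ V : ℝ) * ((n : ℝ) - k) / 2 + s) /
          Real.Gamma ((Module.finrank ℝ V : ℝ) * ((n : ℝ) - k) / 2)) /
        Real.Gamma ((Module.finrank ℝ V : ℝ) * n / 2 + s)) *
      lmellin F ((Module.finrank ℝ V : ℝ) * n / 2 + s) := by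
  obtain ⟨K, hK⟩ := exists_lintegral_tailNormSq_mul_radial (V := V) (Nat.zero_lt_of_lt hk) k s
  have hβ : (0 : ℝ) < Module.finrank ℝ V := by exact_mod_cast Module.finrank_pos
  have has : 0 < (Module.finrank ℝ V : ℝ) * n / 2 + s := by
    have : 0 ≤ (Module.finrank ℝ V : ℝ) * k := by positivity
    linarith
  have hG := Real.Gamma_pos_of_pos has
  have h := hK (fun t => ENNReal.ofReal (Real.exp (-(1 * t)))) (by fun_prop)
  rw [lmellin_exp has one_pos] at h
  simp only [one_mul, Real.one_rpow] at h
  rw [lintegral_tailNormSq_mul_exp hk hs] at h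
  rw [hK F hF, ENNReal.ofReal_div_of_pos hG, h, ENNReal.mul_div_cancel_right
    (by simpa using hG) ENNReal.ofReal_ne_top]

/-! ### Isotropic laws of rows -/

/-- A measure on rows which is invariant under all real-linear maps preserving `|x|²`. -/
def Isotropic {n : ℕ} (μ : Measure (Fin n → V)) : Prop :=
  ∀ L : (Fin n → V) →ₗ[ℝ] (Fin n → V), (∀ x, rowNormSq (L x) = rowNormSq x) → μ.map L = μ

omit [Nontrivial V] in
theorem isotropic_volume (n : ℕ) : Isotropic (volume : Measure (Fin n → V)) := by
  intro L hL
  have := FiniteDimensional.proper_real V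
  have hinj : Function.Injective L := by
    rw [← LinearMap.ker_eq_bot, LinearMap.ker_eq_bot']
    intro x hx
    rw [← rowNormSq_eq_zero, ← hL, hx, rowNormSq_eq_zero]
  have hdet : LinearMap.det L ≠ 0 := by
    have := LinearMap.isUnit_iff_ker_eq_bot L |>.2 (LinearMap.ker_eq_bot.2 hinj)
    exact (LinearMap.isUnit_det L this).ne_zero
  -- The Gaussian weight is invariant and has a finite nonzero integral.
  have h1 : ∫⁻ x : Fin n → V, ENNReal.ofReal (Real.exp (-rowNormSq x)) =
      ENNReal.ofReal |(LinearMap.det L)⁻¹| *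
        ∫⁻ x : Fin n → V, ENNReal.ofReal (Real.exp (-rowNormSq x)) := by
    have hLm : Measurable L := L.continuous_of_finiteDimensional.measurable
    rw [← smul_eq_mul, ← lintegral_smul_measure,
      ← Measure.map_linearMap_addHaar_eq_smul_addHaar volume hdet,
      lintegral_map (by fun_prop) hLm]
    simp_rw [hL]
  rw [lintegral_exp_neg_rowNormSq] at h1
  have h2 : ENNReal.ofReal |(LinearMap.det L)⁻¹| = 1 := by
    refine (ENNReal.mul_left_inj (c := ENNReal.ofReal
      (Real.pi ^ ((Module.finrank ℝ V : ℝ) * n / 2))) ?_ ENNReal.ofReal_ne_top).1 ?_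
    · simpa using Real.rpow_pos_of_pos Real.pi_pos _
    · rw [one_mul]; exact h1.symm
  rw [Measure.map_linearMap_addHaar_eq_smul_addHaar volume hdet, h2, one_smul]

omit [Nontrivial V] in
theorem isotropic_withDensity {n : ℕ} {F : ℝ → ENNReal} (hF : Measurable F) :
    Isotropic ((volume : Measure (Fin n → V)).withDensity fun x => F (rowNormSq x)) := by
  intro L hL
  have := FiniteDimensional.proper_real V
  have hLm : Measurable L := L.continuous_of_finiteDimensional.measurable
  ext A hA
  rw [Measure.map_apply hLm hA, withDensity_apply _ (hLm hA), withDensity_apply _ hA]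
  nth_rw 2 [← isotropic_volume n L hL]
  rw [setLIntegral_map hA (by fun_prop) hLm]
  simp_rw [hL]

omit [Nontrivial V] [(volume : Measure V).IsAddHaarMeasure] [GaussianVolume V] in
theorem Isotropic.map_tail {n : ℕ} {μ : Measure (Fin (n + 1) → V)} (hμ : Isotropic μ) :
    Isotropic (μ.map Fin.tail) := by
  intro L hL
  have := FiniteDimensional.proper_real V
  have hLm : Measurable L := L.continuous_of_finiteDimensional.measurable
  have htail : Measurable (Fin.tail : (Fin (n + 1) → V) → (Fin n → V)) := by
    unfold Fin.tail; fun_prop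
  let L' : (Fin (n + 1) → V) →ₗ[ℝ] (Fin (n + 1) → V) :=
    { toFun := fun x => Fin.cons (x 0) (L (Fin.tail x))
      map_add' := fun x y => by
        have : Fin.tail (x + y) = Fin.tail x + Fin.tail y := rfl
        rw [this, map_add]
        ext i
        cases i using Fin.cases <;> simp
      map_smul' := fun r x => by
        have : Fin.tail (r • x) = r • Fin.tail x := rfl
        rw [this, map_smul]
        ext i
        cases i using Fin.cases <;> simp }
  have hL'm : Measurable L' := L'.continuous_of_finiteDimensional.measurable
  have hL' : ∀ x, rowNormSq (L' x) = rowNormSq x := by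
    intro x
    change rowNormSq (Fin.cons (x 0) (L (Fin.tail x)) : Fin (n + 1) → V) = _
    rw [rowNormSq_succ, rowNormSq_succ x, Fin.tail_cons, Fin.cons_zero, hL]
  have hcomm : L ∘ Fin.tail = Fin.tail ∘ L' := by
    ext x : 1
    change _ = Fin.tail (Fin.cons (x 0) (L (Fin.tail x)) : Fin (n + 1) → V)
    rw [Fin.tail_cons]
    rfl
  rw [Measure.map_map hLm htail, hcomm, ← Measure.map_map htail hL'm, hμ L' hL']

end Rows

/-! ### The three radial profiles -/

/-- `F` is a function of `|x|²` in real dimension `2 a`, with integral one.  Relative to the weight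
`π ^ (-a) * exp (-|x|²)` its moment of order `s` has the additional factor `ψ s`, so that
`c = ψ' 0` is the excess of the mean of `log |x|²`. -/
structure RadialProfile (a : ℝ) (F : ℝ → ENNReal) (ψ : ℝ → ℝ) (c : ℝ) : Prop where
  measurable : Measurable F
  lmellin_eq : ∀ᶠ s in 𝓝 (0 : ℝ),
    lmellin F (a + s) = ENNReal.ofReal (Real.pi ^ (-a) * Real.Gamma (a + s) * ψ s)
  map_zero : ψ 0 = 1
  hasDerivAt : HasDerivAt ψ c 0

theorem eventually_pos_add {a : ℝ} (ha : 0 < a) : ∀ᶠ s in 𝓝 (0 : ℝ), 0 < a + s :=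
  (by fun_prop : Continuous fun s : ℝ => a + s).continuousAt.eventually_const_lt (by simpa)

theorem eventually_pos_sub {a : ℝ} (ha : 0 < a) : ∀ᶠ s in 𝓝 (0 : ℝ), 0 < a - s :=
  (by fun_prop : Continuous fun s : ℝ => a - s).continuousAt.eventually_const_lt (by simpa)

theorem radialProfile_gaussian {a σ : ℝ} (ha : 0 < a) (hσ : 0 < σ) :
    RadialProfile a (fun t => ENNReal.ofReal
      ((2 * Real.pi * σ ^ 2) ^ (-a) * Real.exp (-t / (2 * σ ^ 2))))
      (fun s => (2 * σ ^ 2) ^ s) (Real.log (2 * σ ^ 2)) where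
  measurable := by fun_prop
  lmellin_eq := by
    filter_upwards [eventually_pos_add ha] with s hs
    have h := lmellin_exp hs (b := (2 * σ ^ 2)⁻¹) (by positivity)
    have e : ∀ t : ℝ, -t / (2 * σ ^ 2) = -((2 * σ ^ 2)⁻¹ * t) := fun t => by ring
    simp_rw [e]
    simp_rw [ENNReal.ofReal_mul (Real.rpow_nonneg (by positivity : 0 ≤ 2 * Real.pi * σ ^ 2) (-a))]
    rw [lmellin_const_mul (by fun_prop), h, ← ENNReal.ofReal_mul (by positivity)]
    congr 1
    rw [Real.inv_rpow (by positivity), ← Real.rpow_neg (by positivity), neg_neg,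
      show 2 * Real.pi * σ ^ 2 = Real.pi * (2 * σ ^ 2) by ring,
      Real.mul_rpow Real.pi_pos.le (by positivity), Real.rpow_add (by positivity),
      Real.rpow_neg (by positivity) a, Real.rpow_neg (by positivity) a]
    field_simp
  map_zero := by simp
  hasDerivAt := by
    simpa using (Real.hasStrictDerivAt_const_rpow (by positivity : 0 < 2 * σ ^ 2) 0).hasDerivAt

theorem radialProfile_betaI {a b : ℝ} (ha : 0 < a) (hb : 0 < b) :
    RadialProfile a (fun t => ENNReal.ofReal (open Classical in
      if t < 1 then Real.pi ^ (-a) * pochhammer b a * (1 - t) ^ (b - 1) else 0))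
      (fun s => Real.Gamma (a + b) / Real.Gamma (a + b + s)) (-digamma (a + b)) where
  measurable := by
    refine Measurable.ennreal_ofReal (Measurable.ite measurableSet_Iio ?_ ?_) <;> fun_prop
  lmellin_eq := by
    have hGb := Real.Gamma_pos_of_pos hb
    have hGab := Real.Gamma_pos_of_pos (add_pos ha hb)
    have hp : 0 < Real.pi ^ (-a) * pochhammer b a := by
      rw [pochhammer, add_comm]; positivity
    filter_upwards [eventually_pos_add ha] with s hs
    have h := lmellin_betaI hs hb
    have hGabs := Real.Gamma_pos_of_pos (add_pos hs hb)
    have e : ∀ t : ℝ, ENNReal.ofReal (open Classical in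
      if t < 1 then Real.pi ^ (-a) * pochhammer b a * (1 - t) ^ (b - 1) else 0) =
      ENNReal.ofReal (Real.pi ^ (-a) * pochhammer b a) * ENNReal.ofReal (open Classical in
      if t < 1 then (1 - t) ^ (b - 1) else 0) := fun t => by
        rw [← ENNReal.ofReal_mul hp.le, mul_ite, mul_zero]
    simp_rw [e]
    rw [lmellin_const_mul, h, ← ENNReal.ofReal_mul hp.le]
    · rw [pochhammer, add_comm b a, show a + s + b = a + b + s by ring]
      congr 1
      field_simp
    · refine Measurable.ennreal_ofReal (Measurable.ite measurableSet_Iio ?_ ?_) <;> fun_prop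
  map_zero := by simp [(Real.Gamma_pos_of_pos (add_pos ha hb)).ne']
  hasDerivAt := hasDerivAt_Gamma_ratio_inv (add_pos ha hb)

theorem radialProfile_betaII {a b : ℝ} (ha : 0 < a) (hb : 0 < b) :
    RadialProfile a (fun t => ENNReal.ofReal
      (Real.pi ^ (-a) * pochhammer b a * (1 + t) ^ (-(a + b))))
      (fun s => Real.Gamma (b - s) / Real.Gamma b) (-digamma b) where
  measurable := by fun_prop
  lmellin_eq := by
    have hGb := Real.Gamma_pos_of_pos hb
    have hGab := Real.Gamma_pos_of_pos (add_pos ha hb)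
    have hp : 0 < Real.pi ^ (-a) * pochhammer b a := by
      rw [pochhammer, add_comm]; positivity
    filter_upwards [eventually_pos_add ha, eventually_pos_sub hb] with s hs hs'
    have h := lmellin_betaII hs hs'
    rw [show a + s + (b - s) = a + b by ring] at h
    simp_rw [ENNReal.ofReal_mul hp.le]
    rw [lmellin_const_mul (by fun_prop), h, ← ENNReal.ofReal_mul hp.le, pochhammer, add_comm b a]
    congr 1
    field_simp
  map_zero := by simp [(Real.Gamma_pos_of_pos hb).ne']
  hasDerivAt := hasDerivAt_Gamma_ratio_neg hb

section Rows

variable {V : Type} [NormedAddCommGroup V] [NormedSpace ℝ V] [FiniteDimensional ℝ V]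
  [Nontrivial V] [MeasureSpace V] [BorelSpace V] [(volume : Measure V).IsAddHaarMeasure]
  [GaussianVolume V]

/-- The dependence on `k` of the moments is the same for all radial laws. -/
theorem RadialProfile.lintegral_tailNormSq {n k : ℕ} (hk : k < n) {F : ℝ → ENNReal} {ψ : ℝ → ℝ}
    {c : ℝ} (h : RadialProfile ((Module.finrank ℝ V : ℝ) * n / 2) F ψ c) :
    ∀ᶠ s in 𝓝 (0 : ℝ), ∫⁻ x : Fin n → V, ENNReal.ofReal (tailNormSq k x) ^ s
        ∂((volume : Measure (Fin n → V)).withDensity fun x => F (rowNormSq x)) =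
      ENNReal.ofReal (Real.Gamma ((Module.finrank ℝ V : ℝ) * ((n : ℝ) - k) / 2 + s) /
          Real.Gamma ((Module.finrank ℝ V : ℝ) * ((n : ℝ) - k) / 2) * ψ s) := by
  have hβ : (0 : ℝ) < Module.finrank ℝ V := by exact_mod_cast Module.finrank_pos
  have hk' : (0 : ℝ) < (n : ℝ) - k := by
    rw [sub_pos]; exact_mod_cast hk
  have hn : (0 : ℝ) < n := by exact_mod_cast Nat.zero_lt_of_lt hk
  have hd : 0 < (Module.finrank ℝ V : ℝ) * ((n : ℝ) - k) / 2 := by positivity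
  have ha : 0 < (Module.finrank ℝ V : ℝ) * n / 2 := by positivity
  filter_upwards [h.lmellin_eq, eventually_pos_add hd, eventually_pos_add ha] with s hs hds has
  have hF := h.measurable
  have hG := Real.Gamma_pos_of_pos hd
  have hGs := Real.Gamma_pos_of_pos hds
  have hGas := Real.Gamma_pos_of_pos has
  rw [lintegral_withDensity_eq_lintegral_mul _ (by fun_prop) (by fun_prop)]
  simp only [Pi.mul_apply]
  simp_rw [mul_comm (F _)]
  rw [lintegral_tailNormSq_mul_radial hk hds hF, hs, ← ENNReal.ofReal_mul (by positivity),
    Real.rpow_neg Real.pi_pos.le]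
  congr 1
  generalize Real.Gamma ((Module.finrank ℝ V : ℝ) * n / 2 + s) = g at hGas ⊢
  field_simp

end Rows

section Determinant

/-! ### The modulus of the determinant -/

/-- A representation of `𝕂` by complex `d × d` matrices which computes the modulus `AbsDet.absDet`
of determinants, together with the identity `a a* = |a|²`.  It gives a uniform treatment of the real
numbers and the complex numbers (`d = 1`) and of the quaternions (`d = 2`). -/
class ComplexRep (𝕂 : Type) [NormedRing 𝕂] [StarRing 𝕂] [NormedAlgebra ℝ 𝕂] [AbsDet 𝕂] where
  /-- The size of the representing matrices. -/
  d : ℕ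
  d_pos : 0 < d
  /-- The representing matrix of a number. -/
  rho : 𝕂 →+* Matrix (Fin d) (Fin d) ℂ
  rho_star : ∀ a, rho (star a) = (rho a).conjTranspose
  rho_continuous : Continuous rho
  norm_rho_apply_le : ∀ a i j, ‖rho a i j‖ ≤ ‖a‖
  norm_det_rho : ∀ a, ‖(rho a).det‖ = ‖a‖ ^ d
  mul_star_self : ∀ a : 𝕂, a * star a = algebraMap ℝ 𝕂 (‖a‖ ^ 2)
  absDet_nonneg : ∀ {n : ℕ} (X : Matrix (Fin n) (Fin n) 𝕂), 0 ≤ AbsDet.absDet X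
  absDet_pow : ∀ {n : ℕ} (X : Matrix (Fin n) (Fin n) 𝕂),
    AbsDet.absDet X ^ d =
      ‖(Matrix.of fun (p q : Fin n × Fin d) => rho (X p.1 q.1) p.2 q.2).det‖

open ComplexRep Matrix

variable {𝕂 : Type} [NormedRing 𝕂] [StarRing 𝕂] [NormedAlgebra ℝ 𝕂] [AbsDet 𝕂] [ComplexRep 𝕂]

/-- The complex matrix made of the blocks which represent the entries of `X`. -/
def toComplex {m n : ℕ} (X : Matrix (Fin m) (Fin n) 𝕂) :
    Matrix (Fin m × Fin (d 𝕂)) (Fin n × Fin (d 𝕂)) ℂ :=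
  Matrix.of fun p q => rho (X p.1 q.1) p.2 q.2

theorem toComplex_mul {l m n : ℕ} (X : Matrix (Fin l) (Fin m) 𝕂) (Y : Matrix (Fin m) (Fin n) 𝕂) :
    toComplex (X * Y) = toComplex X * toComplex Y := by
  ext p q
  simp only [toComplex, of_apply, mul_apply, map_sum, map_mul, Fintype.sum_prod_type]
  rw [Matrix.sum_apply]
  simp only [mul_apply]

theorem toComplex_conjTranspose {m n : ℕ} (X : Matrix (Fin m) (Fin n) 𝕂) :
    toComplex Xᴴ = (toComplex X)ᴴ := by
  ext p q
  simp [toComplex, conjTranspose_apply, rho_star]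

theorem toComplex_one {n : ℕ} : toComplex (1 : Matrix (Fin n) (Fin n) 𝕂) = 1 := by
  ext ⟨i, a⟩ ⟨j, b⟩
  by_cases h : i = j
  · subst h
    simp [toComplex, one_apply]
  · simp [toComplex, one_apply, h]

theorem absDet_pow_eq {n : ℕ} (X : Matrix (Fin n) (Fin n) 𝕂) :
    AbsDet.absDet X ^ d 𝕂 = ‖(toComplex X).det‖ :=
  absDet_pow X

theorem absDet_eq_of_pow_eq {n : ℕ} (X : Matrix (Fin n) (Fin n) 𝕂) {c : ℝ} (hc : 0 ≤ c)
    (h : ‖(toComplex X).det‖ = c ^ d 𝕂) : AbsDet.absDet X = c :=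
  (pow_left_inj₀ (absDet_nonneg X) hc (d_pos (𝕂 := 𝕂)).ne').1 (by rw [absDet_pow_eq, h])

theorem absDet_mul {n : ℕ} (X Y : Matrix (Fin n) (Fin n) 𝕂) :
    AbsDet.absDet (X * Y) = AbsDet.absDet X * AbsDet.absDet Y := by
  refine absDet_eq_of_pow_eq _ (mul_nonneg (absDet_nonneg X) (absDet_nonneg Y)) ?_
  rw [toComplex_mul, det_mul, norm_mul, mul_pow, absDet_pow_eq, absDet_pow_eq]

theorem absDet_one {n : ℕ} : AbsDet.absDet (1 : Matrix (Fin n) (Fin n) 𝕂) = 1 :=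
  absDet_eq_of_pow_eq _ zero_le_one (by rw [toComplex_one, det_one, norm_one, one_pow])

theorem absDet_conjTranspose {n : ℕ} (X : Matrix (Fin n) (Fin n) 𝕂) :
    AbsDet.absDet Xᴴ = AbsDet.absDet X := by
  refine absDet_eq_of_pow_eq _ (absDet_nonneg X) ?_
  rw [toComplex_conjTranspose, det_conjTranspose, norm_star, absDet_pow_eq]

theorem absDet_eq_norm_mul {n : ℕ} (X : Matrix (Fin (n + 1)) (Fin (n + 1)) 𝕂)
    (h : ∀ j : Fin n, X 0 j.succ = 0) :
    AbsDet.absDet X = ‖X 0 0‖ * AbsDet.absDet (X.submatrix Fin.succ Fin.succ) := by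
  refine absDet_eq_of_pow_eq _ (mul_nonneg (norm_nonneg _) (absDet_nonneg _)) ?_
  let e : Fin (d 𝕂) ⊕ (Fin n × Fin (d 𝕂)) ≃ Fin (n + 1) × Fin (d 𝕂) :=
    { toFun := Sum.elim (fun a => (0, a)) (fun p => (p.1.succ, p.2))
      invFun := fun p => Fin.cases (Sum.inl p.2) (fun i => Sum.inr (i, p.2)) p.1
      left_inv := by rintro (a | ⟨i, a⟩) <;> simp
      right_inv := by
        rintro ⟨i, a⟩
        cases i using Fin.cases <;> simp }
  have hblock : (toComplex X).submatrix e e =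
      fromBlocks (rho (X 0 0)) 0 (of fun (p : Fin n × Fin (d 𝕂)) a => rho (X p.1.succ 0) p.2 a)
        (toComplex (X.submatrix Fin.succ Fin.succ)) := by
    ext (a | ⟨i, a⟩) (b | ⟨j, b⟩) <;> simp [e, toComplex, h]
  rw [← det_submatrix_equiv_self e, hblock, det_fromBlocks_zero₁₂, norm_mul, norm_det_rho, mul_pow,
    absDet_pow_eq]

/-- An injective real-linear endomorphism of `𝕂 ^ n` is surjective, which gives a right inverse
without linear algebra over the noncommutative `𝕂`. -/
theorem absDet_ne_zero_of_columnsIndependent {n : ℕ} {X : Matrix (Fin n) (Fin n) 𝕂}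
    [FiniteDimensional ℝ 𝕂] (h : ColumnsIndependent X) : AbsDet.absDet X ≠ 0 := by
  let f : (Fin n → 𝕂) →ₗ[ℝ] (Fin n → 𝕂) :=
    { toFun := X.mulVec
      map_add' := fun x y => mulVec_add X x y
      map_smul' := fun r x => mulVec_smul X r x }
  have hinj : Function.Injective f := by
    rw [← LinearMap.ker_eq_bot, LinearMap.ker_eq_bot']
    exact h
  have hsurj : Function.Surjective f := LinearMap.injective_iff_surjective.1 hinj
  choose g hg using hsurj
  have h1 : X * (of fun i j => g (Pi.single j 1) i) = 1 := by
    ext i j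
    have := congrFun (hg (Pi.single j 1)) i
    rw [mul_apply]
    simp only [of_apply]
    rw [one_apply]
    change X.mulVec (g (Pi.single j 1)) i = _ at this
    rw [mulVec, dotProduct] at this
    rw [this, Pi.single_apply]
  intro h0
  have h2 := absDet_mul X (of fun i j => g (Pi.single j 1) i)
  rw [h1, absDet_one, h0, zero_mul] at h2
  exact one_ne_zero h2

theorem continuous_absDet {n : ℕ} :
    Continuous (AbsDet.absDet : Matrix (Fin n) (Fin n) 𝕂 → ℝ) := by
  have h1 : Continuous fun X : Matrix (Fin n) (Fin n) 𝕂 => ‖(toComplex X).det‖ := by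
    refine (Continuous.matrix_det ?_).norm
    refine continuous_matrix fun p q => ?_
    exact (rho_continuous.comp (continuous_apply_apply p.1 q.1)).matrix_elem p.2 q.2
  have h2 : (AbsDet.absDet : Matrix (Fin n) (Fin n) 𝕂 → ℝ) =
      fun X => ‖(toComplex X).det‖ ^ ((d 𝕂 : ℝ)⁻¹) := by
    funext X
    rw [← absDet_pow_eq, Real.pow_rpow_inv_natCast (absDet_nonneg X) (d_pos (𝕂 := 𝕂)).ne']
  rw [h2]
  exact h1.rpow_const fun X => Or.inr (by positivity)

/-! ### Reflections -/

theorem dotProduct_star_self {n : ℕ} (y : Fin n → 𝕂) :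
    y ⬝ᵥ star y = algebraMap ℝ 𝕂 (rowNormSq y) := by
  simp only [dotProduct, Pi.star_apply, mul_star_self, rowNormSq, map_sum]

variable [StarModule ℝ 𝕂] [NormOneClass 𝕂] [Nontrivial 𝕂]

/-- A Householder reflection takes a given row to a multiple of the first basis vector; by its choice
the vector `w` along which it reflects has a real product with the given row, also over the
quaternions. -/
theorem exists_reflection {n : ℕ} {x : Fin (n + 1) → 𝕂} (hx : x ≠ 0) :
    ∃ H : Matrix (Fin (n + 1)) (Fin (n + 1)) 𝕂, (∀ y, rowNormSq (y ᵥ* H) = rowNormSq y) ∧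
      AbsDet.absDet H = 1 ∧ ∃ c : 𝕂, ‖c‖ ^ 2 = rowNormSq x ∧ x ᵥ* H = Pi.single 0 c := by
  have hstar_alg : ∀ r : ℝ, star (algebraMap ℝ 𝕂 r) = algebraMap ℝ 𝕂 r := fun r =>
    (algebraMap_star_comm r).symm
  have hsmul : ∀ r t : ℝ, r • algebraMap ℝ 𝕂 t = algebraMap ℝ 𝕂 (r * t) := fun r t => by
    rw [map_mul, Algebra.smul_def]
  -- `q` is the phase of `x 0`; the vector `w` below is `x + r q e₀`, of square `2 p`.
  obtain ⟨q, hq1, hq2⟩ : ∃ q : 𝕂, ‖q‖ = 1 ∧ x 0 * star q = algebraMap ℝ 𝕂 ‖x 0‖ := by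
    by_cases h0 : x 0 = 0
    · exact ⟨1, norm_one, by simp [h0]⟩
    · have hn : ‖x 0‖ ≠ 0 := norm_ne_zero_iff.2 h0
      refine ⟨‖x 0‖⁻¹ • x 0, by simp [norm_smul, hn], ?_⟩
      rw [star_smul, mul_smul_comm, mul_star_self, star_trivial, hsmul]
      congr 1
      field_simp
  have hqq : q * star q = 1 := by rw [mul_star_self, hq1]; simp
  have hq3 : q * star (x 0) = algebraMap ℝ 𝕂 ‖x 0‖ := by
    rw [← hstar_alg, ← hq2, star_mul, star_star]
  have hpos : 0 < rowNormSq x :=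
    lt_of_le_of_ne (rowNormSq_nonneg x) fun h => hx (rowNormSq_eq_zero.1 h.symm)
  set r : ℝ := Real.sqrt (rowNormSq x) with hr
  have hr0 : 0 < r := Real.sqrt_pos.2 hpos
  have hrr : r * r = rowNormSq x := Real.mul_self_sqrt hpos.le
  set p : ℝ := rowNormSq x + r * ‖x 0‖ with hp
  have hp0 : 0 < p := by positivity
  let w : Fin (n + 1) → 𝕂 := x + Pi.single 0 (r • q)
  have hw0 : w 0 = x 0 + r • q := by simp [w]
  have hxw : x ⬝ᵥ star w = algebraMap ℝ 𝕂 p := by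
    have : star w = star x + Pi.single 0 (star (r • q)) := by
      rw [star_add, ← Pi.single_star]
    rw [this, dotProduct_add, dotProduct_star_self, dotProduct_single, star_smul, mul_smul_comm,
      hq2, star_trivial, hsmul, ← map_add]
  have hww : w ⬝ᵥ star w = algebraMap ℝ 𝕂 (2 * p) := by
    change (x + Pi.single 0 (r • q)) ⬝ᵥ star w = _
    rw [add_dotProduct, hxw, single_dotProduct, Pi.star_apply, hw0, star_add, star_smul,
      star_trivial r, mul_add, smul_mul_assoc, smul_mul_assoc, mul_smul_comm, hq3, hqq,
      Algebra.algebraMap_eq_smul_one, Algebra.algebraMap_eq_smul_one, Algebra.algebraMap_eq_smul_one,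
      smul_smul, smul_smul, ← add_smul, ← add_smul]
    congr 1
    rw [hp, hrr]
    ring
  let W : Matrix (Fin (n + 1)) (Fin (n + 1)) 𝕂 := vecMulVec (star w) w
  have hWW : W * W = (2 * p) • W := by
    ext i j
    have : ∑ k, w k * star w k = algebraMap ℝ 𝕂 (2 * p) := hww
    simp only [W, mul_apply, vecMulVec_apply, Matrix.smul_apply]
    have h2 : ∀ k, star w i * w k * (star w k * w j) = star w i * (w k * star w k) * w j := by
      intro k; simp only [mul_assoc]
    simp_rw [h2]
    rw [← Finset.sum_mul, ← Finset.mul_sum, this, Algebra.algebraMap_eq_smul_one, mul_smul_comm,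
      mul_one, smul_mul_assoc]
  let H : Matrix (Fin (n + 1)) (Fin (n + 1)) 𝕂 := 1 - p⁻¹ • W
  have hHH : H * H = 1 := by
    simp only [H, mul_sub, sub_mul, one_mul, mul_one, smul_mul_assoc, mul_smul_comm, hWW, smul_smul]
    rw [show p⁻¹ * (2 * p) = 2 by field_simp, two_smul]
    simp
  have hHs : Hᴴ = H := by
    simp only [H, W, conjTranspose_sub, conjTranspose_one, conjTranspose_smul, star_trivial,
      conjTranspose_vecMulVec, star_star]
  refine ⟨H, fun y => ?_, ?_, -(r • q), ?_, ?_⟩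
  · apply (algebraMap ℝ 𝕂).injective
    rw [← dotProduct_star_self, star_vecMul, hHs, dotProduct_mulVec, vecMul_vecMul, hHH, vecMul_one,
      dotProduct_star_self]
  · have h := absDet_mul H H
    rw [hHH, absDet_one] at h
    nlinarith [absDet_nonneg H]
  · rw [norm_neg, norm_smul, hq1, mul_one, Real.norm_of_nonneg hr0.le, sq, hrr]
  · rw [vecMul_sub, vecMul_one, vecMul_smul, vecMul_vecMulVec, hxw]
    have : (algebraMap ℝ 𝕂 p) • w = p • w := by
      ext i; simp [Algebra.algebraMap_eq_smul_one]
    rw [this, smul_smul, inv_mul_cancel₀ hp0.ne', one_smul]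
    ext i
    cases i using Fin.cases <;> simp [w]

end Determinant

section Moments

open ComplexRep Matrix

variable {𝕂 : Type} [NormedRing 𝕂] [StarRing 𝕂] [NormedAlgebra ℝ 𝕂] [AbsDet 𝕂] [ComplexRep 𝕂]
  [FiniteDimensional ℝ 𝕂] [MeasureSpace 𝕂] [BorelSpace 𝕂]

/-! ### Moments of the determinant -/

theorem measurable_absDet {n : ℕ} :
    Measurable (AbsDet.absDet : Matrix (Fin n) (Fin n) 𝕂 → ℝ) := by
  have := FiniteDimensional.proper_real 𝕂
  have h : Continuous fun X : Fin n → Fin n → 𝕂 => (AbsDet.absDet (Matrix.of X) : ℝ) :=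
    continuous_absDet
  exact h.measurable

theorem measurable_absDet_of {n : ℕ} :
    Measurable fun X : Fin n → Fin n → 𝕂 => (AbsDet.absDet (Matrix.of X) : ℝ) :=
  measurable_absDet

variable [StarModule ℝ 𝕂] [NormOneClass 𝕂] [Nontrivial 𝕂]

/-- The moments of `|det X|²` for independent isotropic rows.  Given the first row, an isometry
takes it to a multiple of the first basis vector without changing the joint law of the other rows;
expanding along the first row leaves a determinant of size one less, whose rows are again
isotropic. -/
theorem lintegral_absDet_sq_rpow {n : ℕ} (μ : Fin n → Measure (Fin n → 𝕂))
    [hμ : ∀ l, IsProbabilityMeasure (μ l)] (hiso : ∀ l, Isotropic (μ l))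
    (hne : ∀ l : Fin n, ∀ᵐ x ∂μ l, 0 < tailNormSq l x) (s : ℝ) :
    ∫⁻ X, ENNReal.ofReal (AbsDet.absDet (Matrix.of X) ^ 2) ^ s ∂Measure.pi μ =
      ∏ l : Fin n, ∫⁻ x, ENNReal.ofReal (tailNormSq l x) ^ s ∂μ l := by
  have := FiniteDimensional.proper_real 𝕂
  induction n with
  | zero =>
    have h : ∀ X : Fin 0 → Fin 0 → 𝕂, (AbsDet.absDet (Matrix.of X) : ℝ) = 1 := fun X => by
      rw [Subsingleton.elim (Matrix.of X) 1, absDet_one]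
    simp [h]
  | succ n ih =>
    have htail : Measurable (Fin.tail : (Fin (n + 1) → 𝕂) → (Fin n → 𝕂)) := by
      unfold Fin.tail; fun_prop
    have hm := measurable_absDet_of (𝕂 := 𝕂) (n := n)
    have hm' := measurable_absDet_of (𝕂 := 𝕂) (n := n + 1)
    have hprob : ∀ j : Fin n, IsProbabilityMeasure ((μ j.succ).map Fin.tail) := fun j =>
      Measure.isProbabilityMeasure_map htail.aemeasurable
    have hih := ih (fun j => (μ j.succ).map Fin.tail) (fun j => (hiso _).map_tail) (fun j => by
      rw [ae_map_iff htail.aemeasurable (measurableSet_lt measurable_const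
        (measurable_tailNormSq _))]
      filter_upwards [hne j.succ] with x hx
      rw [← tailNormSq_succ]
      exact hx)
    have key : ∀ᵐ a ∂μ 0, ∫⁻ Y, ENNReal.ofReal (AbsDet.absDet (Matrix.of
          (Fin.cons a Y : Fin (n + 1) → Fin (n + 1) → 𝕂)) ^ 2) ^ s
            ∂(Measure.pi fun j : Fin n => μ j.succ) =
        ENNReal.ofReal (tailNormSq 0 a) ^ s *
          ∏ j : Fin n, ∫⁻ x, ENNReal.ofReal (tailNormSq j x) ^ s ∂((μ j.succ).map Fin.tail) := by
      filter_upwards [hne 0] with a (ha : 0 < tailNormSq 0 a)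
      have ha0 : a ≠ 0 := by
        rintro rfl
        simp [tailNormSq] at ha
      obtain ⟨H, hH, hdet, c, hc, hac⟩ := exists_reflection ha0
      let L : (Fin (n + 1) → 𝕂) →ₗ[ℝ] (Fin (n + 1) → 𝕂) :=
        { toFun := fun y => y ᵥ* H
          map_add' := fun x y => add_vecMul H x y
          map_smul' := fun r x => smul_vecMul r x H }
      have hLm : Measurable L := L.continuous_of_finiteDimensional.measurable
      have hexp : ∀ Y : Fin n → Fin (n + 1) → 𝕂, (AbsDet.absDet (Matrix.of
          (Fin.cons a Y : Fin (n + 1) → Fin (n + 1) → 𝕂)) : ℝ) =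
          ‖c‖ * AbsDet.absDet (Matrix.of fun j => Fin.tail (L (Y j))) := by
        intro Y
        set M : Matrix (Fin (n + 1)) (Fin (n + 1)) 𝕂 := Matrix.of (Fin.cons a Y) with hM
        have h0 : ∀ j, (M * H) 0 j = (Pi.single 0 c : Fin (n + 1) → 𝕂) j := by
          intro j
          rw [← hac]
          rfl
        have h1 := absDet_eq_norm_mul (M * H) fun j => by rw [h0]; simp
        rw [absDet_mul, hdet, mul_one, h0, Pi.single_eq_same] at h1
        rw [h1]
        rfl
      have hpi : (Measure.pi fun j : Fin n => μ j.succ).map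
          (fun Y j => Fin.tail (L (Y j))) =
          Measure.pi fun j : Fin n => (μ j.succ).map Fin.tail := by
        have hmap : ∀ j : Fin n, (μ j.succ).map (fun x => Fin.tail (L x)) =
            (μ j.succ).map Fin.tail := fun j => by
          change (μ j.succ).map (Fin.tail ∘ L) = _
          rw [← Measure.map_map htail hLm, hiso j.succ L hH]
        have hsig : ∀ j : Fin n, SigmaFinite ((μ j.succ).map (fun x => Fin.tail (L x))) :=
          fun j => by rw [hmap]; infer_instance
        rw [Measure.pi_map_pi (hμ := hsig) fun j => (htail.comp hLm).aemeasurable]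
        simp_rw [hmap]
      have hmeas : Measurable fun (Y : Fin n → Fin (n + 1) → 𝕂) j => Fin.tail (L (Y j)) :=
        measurable_pi_lambda _ fun j => (htail.comp hLm).comp (measurable_pi_apply j)
      simp_rw [hexp, mul_pow]
      rw [← hih, ← hpi, lintegral_map (by fun_prop) hmeas,
        ← lintegral_const_mul' _ _ (by
          rw [ENNReal.ofReal_rpow_of_pos ha]; exact ENNReal.ofReal_ne_top)]
      refine lintegral_congr fun Y => ?_
      rw [ENNReal.ofReal_mul (by positivity), ENNReal.mul_rpow_of_ne_top ENNReal.ofReal_ne_top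
        ENNReal.ofReal_ne_top, hc, tailNormSq_zero]
    rw [lintegral_pi_succ _ (by fun_prop), lintegral_congr_ae key,
      lintegral_mul_const _ (by fun_prop), Fin.prod_univ_succ]
    congr 1
    refine Finset.prod_congr rfl fun j _ => ?_
    rw [lintegral_map (by fun_prop) htail]
    refine lintegral_congr fun x => ?_
    rw [← tailNormSq_succ]
    rfl

/-! ### The mean of the logarithm of the determinant -/

variable [(volume : Measure 𝕂).IsAddHaarMeasure] [GaussianVolume 𝕂]

/-- The logarithmic mean of `|det X|`, and what the law of large numbers needs: all rows have
integrable logarithmic length, and `det X` is almost surely nonzero. -/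
theorem mean_log_absDet {n : ℕ} {F : Fin n → ℝ → ENNReal} {ψ : Fin n → ℝ → ℝ} {c : Fin n → ℝ}
    (hF : ∀ l, RadialProfile ((Module.finrank ℝ 𝕂 : ℝ) * n / 2) (F l) (ψ l) (c l))
    {μ : Fin n → Measure (Fin n → 𝕂)}
    (hμ : ∀ l, μ l = (volume : Measure (Fin n → 𝕂)).withDensity fun x => F l (rowNormSq x)) :
    (∀ l, IsProbabilityMeasure (μ l)) ∧
    (∀ l, Integrable (fun x => Real.log (rowNormSq x)) (μ l)) ∧
    (∀ᵐ X ∂Measure.pi μ, 0 < AbsDet.absDet (Matrix.of X)) ∧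
    Integrable (fun X => Real.log (AbsDet.absDet (Matrix.of X))) (Measure.pi μ) ∧
    ∫ X, Real.log (AbsDet.absDet (Matrix.of X)) ∂Measure.pi μ = 1 / 2 * ∑ l : Fin n,
      (digamma ((Module.finrank ℝ 𝕂 : ℝ) * ((n : ℝ) - (l : ℕ)) / 2) + c l) := by
  have hβ : (0 : ℝ) < Module.finrank ℝ 𝕂 := by exact_mod_cast Module.finrank_pos
  have hpos : ∀ {k : ℕ}, k < n → 0 < (Module.finrank ℝ 𝕂 : ℝ) * ((n : ℝ) - k) / 2 := by
    intro k hk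
    have : (0 : ℝ) < (n : ℝ) - k := by rw [sub_pos]; exact_mod_cast hk
    positivity
  let φ : Fin n → ℕ → ℝ → ℝ := fun l k s =>
    Real.Gamma ((Module.finrank ℝ 𝕂 : ℝ) * ((n : ℝ) - k) / 2 + s) /
      Real.Gamma ((Module.finrank ℝ 𝕂 : ℝ) * ((n : ℝ) - k) / 2) * ψ l s
  have hφ0 : ∀ l (k : ℕ), k < n → φ l k 0 = 1 := by
    intro l k hk
    simp [φ, (hF l).map_zero, (Real.Gamma_pos_of_pos (hpos hk)).ne']
  have hφd : ∀ l (k : ℕ), k < n → HasDerivAt (φ l k)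
      (digamma ((Module.finrank ℝ 𝕂 : ℝ) * ((n : ℝ) - k) / 2) + c l) 0 := by
    intro l k hk
    have := (hasDerivAt_Gamma_ratio (hpos hk)).mul (hF l).hasDerivAt
    exact this.congr_deriv (by simp [(hF l).map_zero, (Real.Gamma_pos_of_pos (hpos hk)).ne'])
  have hmom : ∀ l (k : ℕ), k < n → ∀ᶠ s in 𝓝 (0 : ℝ),
      ∫⁻ x, ENNReal.ofReal (tailNormSq k x) ^ s ∂μ l = ENNReal.ofReal (φ l k s) := by
    intro l k hk
    rw [hμ l]
    exact (hF l).lintegral_tailNormSq hk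
  have hrow := fun l (k : ℕ) (hk : k < n) =>
    mean_log_of_moments (measurable_tailNormSq k) (hφd l k hk) (hφ0 l k hk) (hmom l k hk)
  have hprob : ∀ l, IsProbabilityMeasure (μ l) := fun l => (hrow l l l.2).1
  have hiso : ∀ l, Isotropic (μ l) := fun l => by
    rw [hμ l]; exact isotropic_withDensity (hF l).measurable
  have hdet : ∀ᶠ s in 𝓝 (0 : ℝ),
      ∫⁻ X, ENNReal.ofReal (AbsDet.absDet (Matrix.of X) ^ 2) ^ s ∂Measure.pi μ =
        ENNReal.ofReal (∏ l : Fin n, φ l l s) := by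
    have hφpos : ∀ l : Fin n, ∀ᶠ s in 𝓝 (0 : ℝ), 0 < φ l l s := fun l =>
      (hφd l l l.2).continuousAt.eventually_const_lt (by rw [hφ0 l l l.2]; exact one_pos)
    filter_upwards [eventually_all.2 fun l : Fin n => hmom l l l.2, eventually_all.2 hφpos]
      with s hs hp
    rw [lintegral_absDet_sq_rpow μ hiso (fun l => (hrow l l l.2).2.1) s,
      ENNReal.ofReal_prod_of_nonneg fun l _ => (hp l).le]
    exact Finset.prod_congr rfl fun l _ => hs l
  have hprodd : HasDerivAt (fun s => ∏ l : Fin n, φ l l s) (∑ l : Fin n,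
      (digamma ((Module.finrank ℝ 𝕂 : ℝ) * ((n : ℝ) - (l : ℕ)) / 2) + c l)) 0 := by
    have h := HasDerivAt.fun_finsetProd (u := Finset.univ) fun (l : Fin n) _ => hφd l l l.2
    refine h.congr_deriv (Finset.sum_congr rfl fun l _ => ?_)
    rw [Finset.prod_eq_one fun j _ => hφ0 j j j.2, one_smul]
  obtain ⟨-, h1, h2, h3⟩ := mean_log_of_moments (measurable_absDet_of.pow_const 2) hprodd
    (Finset.prod_eq_one fun j _ => hφ0 j j j.2) hdet
  have hlog : ∀ X : Fin n → Fin n → 𝕂, Real.log (AbsDet.absDet (Matrix.of X)) =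
      1 / 2 * Real.log (AbsDet.absDet (Matrix.of X) ^ 2) := by
    intro X
    rw [Real.log_pow]
    push_cast
    ring
  refine ⟨hprob, fun l => ?_, ?_, ?_, ?_⟩
  · have := (hrow l 0 (Nat.zero_lt_of_lt l.2)).2.2.1
    simpa only [tailNormSq_zero] using this
  · filter_upwards [h1] with X hX
    exact (absDet_nonneg _).lt_of_ne' fun h => by simp [h] at hX
  · simp_rw [hlog]
    exact h2.const_mul _
  · simp_rw [hlog]
    rw [integral_const_mul, h3]

end Moments

section Bounds

open ComplexRep Matrix
open scoped Matrix.Norms.Frobenius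

/-! ### Bounds for volumes -/

theorem norm_apply_le_frobenius {m n : Type*} [Fintype m] [Fintype n] (A : Matrix m n ℂ)
    (i : m) (j : n) : ‖A i j‖ ≤ ‖A‖ := by
  have h : ‖A‖ ^ 2 = ∑ i, ∑ j, ‖A i j‖ ^ 2 := by
    rw [frobenius_norm_def, ← Real.rpow_natCast, ← Real.rpow_mul (by positivity)]
    simp
  refine le_of_sq_le_sq ?_ (norm_nonneg _)
  rw [h]
  calc ‖A i j‖ ^ 2 ≤ ∑ j, ‖A i j‖ ^ 2 :=
        Finset.single_le_sum (f := fun j => ‖A i j‖ ^ 2) (fun _ _ => by positivity)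
          (Finset.mem_univ j)
    _ ≤ _ := Finset.single_le_sum (f := fun i => ∑ j, ‖A i j‖ ^ 2)
        (fun _ _ => by positivity) (Finset.mem_univ i)

theorem frobenius_norm_le {n : Type*} [Fintype n] (A : Matrix n n ℂ) {b : ℝ} (hb : 0 ≤ b)
    (h : ∀ i j, ‖A i j‖ ≤ b) : ‖A‖ ≤ Fintype.card n * b := by
  have h2 : ‖A‖ ^ 2 = ∑ i, ∑ j, ‖A i j‖ ^ 2 := by
    rw [frobenius_norm_def, ← Real.rpow_natCast, ← Real.rpow_mul (by positivity)]
    simp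
  refine le_of_sq_le_sq ?_ (by positivity)
  rw [h2]
  calc ∑ i, ∑ j, ‖A i j‖ ^ 2 ≤ ∑ _i : n, ∑ _j : n, b ^ 2 :=
        Finset.sum_le_sum fun i _ => Finset.sum_le_sum fun j _ =>
          pow_le_pow_left₀ (norm_nonneg _) (h i j) 2
    _ = _ := by simp; ring

theorem norm_det_le {n : Type*} [Fintype n] [DecidableEq n] (A : Matrix n n ℂ) {b : ℝ}
    (h : ∀ i j, ‖A i j‖ ≤ b) : ‖A.det‖ ≤ (Fintype.card n).factorial * b ^ Fintype.card n := by
  have := Matrix.det_le (A := A) (abv := NormedField.toAbsoluteValue ℂ) (x := b) h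
  rwa [nsmul_eq_mul] at this

theorem norm_det_gram_le {m n : Type*} [Fintype m] [Fintype n] [DecidableEq n]
    (B : Matrix m n ℂ) :
    ‖(Bᴴ * B).det‖ ≤ (Fintype.card n).factorial * (‖B‖ ^ 2) ^ Fintype.card n := by
  refine norm_det_le _ fun i j => (norm_apply_le_frobenius _ i j).trans ?_
  refine (frobenius_norm_mul _ _).trans ?_
  rw [frobenius_norm_conjTranspose, sq]

/-- The Gram determinant of a matrix with a left inverse `Q` is bounded below, because each
eigenvalue of the Gram matrix is at least `‖Q‖ ^ (-2)`. -/
theorem one_le_norm_det_gram_mul {m n : Type*} [Fintype m] [Fintype n] [DecidableEq n]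
    {B : Matrix m n ℂ} {Q : Matrix n m ℂ} (h : Q * B = 1) :
    1 ≤ ‖(Bᴴ * B).det‖ * (‖Q‖ ^ 2) ^ Fintype.card n := by
  have hA : (Bᴴ * B).IsHermitian := isHermitian_conjTranspose_mul_self B
  have hev : ∀ i, 1 ≤ hA.eigenvalues i * ‖Q‖ ^ 2 := by
    intro i
    set v : EuclideanSpace ℂ n := hA.eigenvectorBasis i with hv
    have hv1 : ‖v‖ = 1 := hA.eigenvectorBasis.orthonormal.1 i
    have h1 : hA.eigenvalues i = ‖WithLp.toLp 2 (B *ᵥ v.ofLp)‖ ^ 2 := by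
      rw [hA.eigenvalues_eq, ← hv, ← mulVec_mulVec, dotProduct_mulVec, ← star_mulVec,
        EuclideanSpace.norm_sq_eq]
      simp only [dotProduct, Pi.star_apply, map_sum]
      refine Finset.sum_congr rfl fun k _ => ?_
      rw [mul_comm, RCLike.star_def, RCLike.mul_conj]
      norm_cast
    have h2 : ‖v‖ ≤ ‖Q‖ * ‖WithLp.toLp 2 (B *ᵥ v.ofLp)‖ := by
      have e : replicateCol Unit v.ofLp = Q * replicateCol Unit (B *ᵥ v.ofLp) := by
        rw [← replicateCol_mulVec, mulVec_mulVec, h, one_mulVec]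
      have := frobenius_norm_mul Q (replicateCol Unit (B *ᵥ v.ofLp))
      rwa [← e, frobenius_norm_replicateCol, frobenius_norm_replicateCol] at this
    rw [hv1] at h2
    rw [h1, ← mul_pow, mul_comm]
    exact one_le_pow₀ h2
  rw [hA.det_eq_prod_eigenvalues, norm_prod, ← Finset.card_univ, ← Finset.prod_const,
    ← Finset.prod_mul_distrib]
  have : ∀ i ∈ (Finset.univ : Finset n), 1 ≤ ‖((hA.eigenvalues i : ℝ) : ℂ)‖ * ‖Q‖ ^ 2 := by
    intro i _
    have hnn : 0 ≤ hA.eigenvalues i := by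
      by_contra hneg
      have := hev i
      nlinarith [sq_nonneg ‖Q‖]
    rw [Complex.norm_real, Real.norm_of_nonneg hnn]
    exact hev i
  calc (1 : ℝ) = ∏ _i : n, 1 := by simp
    _ ≤ _ := Finset.prod_le_prod (fun _ _ => zero_le_one) this

section Volumes

variable {𝕂 : Type} [NormedRing 𝕂] [StarRing 𝕂] [NormedAlgebra ℝ 𝕂] [AbsDet 𝕂] [ComplexRep 𝕂]
  {N : ℕ}

/-- A bound for the logarithms of the norms of `toComplex X` and of its inverse, for invertible `X`. -/
noncomputable def logNormBound (X : Matrix (Fin N) (Fin N) 𝕂) : ℝ :=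
  Real.log (N * d 𝕂 * (N * d 𝕂).factorial + 1) +
    (N * d 𝕂 + 1) * (1 / 2 * ∑ l, Real.log (1 + rowNormSq (X l))) +
    d 𝕂 * |Real.log (AbsDet.absDet X)|

/-- The entries of the adjugate are determinants, which bounds the inverse by `|det X|` and the
entries of `X`. -/
theorem norm_toComplex_le_exp_logNormBound {X : Matrix (Fin N) (Fin N) 𝕂}
    (hX : AbsDet.absDet X ≠ 0) :
    ‖toComplex X‖ ≤ Real.exp (logNormBound X) ∧ ‖(toComplex X)⁻¹‖ ≤ Real.exp (logNormBound X) := by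
  have hX0 : 0 < AbsDet.absDet X := (absDet_nonneg X).lt_of_ne' hX
  set D : ℕ := N * d 𝕂 with hD
  have hcard : Fintype.card (Fin N × Fin (d 𝕂)) = D := by simp [hD]
  set h : ℝ := 1 / 2 * ∑ l, Real.log (1 + rowNormSq (X l)) with hh
  have hterm : ∀ l, 0 ≤ Real.log (1 + rowNormSq (X l)) := fun l =>
    Real.log_nonneg (by linarith [rowNormSq_nonneg (X l)])
  have hh0 : 0 ≤ h := by
    have := Finset.sum_nonneg fun l (_ : l ∈ Finset.univ) => hterm l
    positivity
  -- `B` bounds all entries of `toComplex X`, and also the entry `1` in the minors of the adjugate.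
  set B : ℝ := Real.exp h with hB
  have hB1 : 1 ≤ B := Real.one_le_exp hh0
  have hentry : ∀ p q, ‖toComplex X p q‖ ≤ B := by
    intro p q
    refine (norm_rho_apply_le _ _ _).trans ?_
    have h1 : ‖X p.1 q.1‖ ^ 2 ≤ rowNormSq (X p.1) :=
      Finset.single_le_sum (f := fun j => ‖X p.1 j‖ ^ 2) (fun _ _ => by positivity)
        (Finset.mem_univ q.1)
    have h2 : Real.log (1 + rowNormSq (X p.1)) ≤ 2 * h := by
      have := Finset.single_le_sum (f := fun l => Real.log (1 + rowNormSq (X l)))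
        (fun l _ => hterm l) (Finset.mem_univ p.1)
      linarith
    have h3 : 1 + rowNormSq (X p.1) ≤ B ^ 2 := by
      rw [hB, ← Real.exp_nat_mul]
      push_cast
      exact (Real.log_le_iff_le_exp (by linarith [rowNormSq_nonneg (X p.1)])).1 h2
    exact le_of_sq_le_sq (by linarith) (by positivity)
  set C : ℝ := (D : ℝ) * D.factorial + 1 with hC
  have hC1 : 1 ≤ C := by
    have : (0 : ℝ) ≤ (D : ℝ) * D.factorial := by positivity
    linarith
  set t : ℝ := (d 𝕂 : ℝ) * |Real.log (AbsDet.absDet X)| with ht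
  have ht0 : 0 ≤ t := by positivity
  have hg : Real.exp (logNormBound X) = C * B ^ (D + 1) * Real.exp t := by
    have : logNormBound X = Real.log C + ((D + 1 : ℕ) : ℝ) * h + t := by
      simp only [logNormBound, hC, hD, hh, ht]
      push_cast
      ring
    rw [this, Real.exp_add, Real.exp_add, Real.exp_log (by linarith), Real.exp_nat_mul]
  have ht1 : 1 ≤ Real.exp t := Real.one_le_exp ht0
  have hDC : (D : ℝ) ≤ C := by
    have : (1 : ℝ) ≤ D.factorial := by exact_mod_cast D.factorial_pos
    have : (0 : ℝ) ≤ D := by positivity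
    nlinarith
  rw [hg]
  constructor
  · have h1 := frobenius_norm_le (toComplex X) (by positivity) hentry
    rw [hcard] at h1
    calc ‖toComplex X‖ ≤ D * B := h1
      _ ≤ C * B ^ (D + 1) * 1 := by
        rw [mul_one]
        exact mul_le_mul hDC (le_self_pow₀ hB1 (by omega)) (by positivity) (by positivity)
      _ ≤ _ := by gcongr
  · have hadj : ∀ p q, ‖(toComplex X).adjugate p q‖ ≤ D.factorial * B ^ D := by
      intro p q
      rw [adjugate_apply, ← hcard]
      refine norm_det_le _ fun i j => ?_
      rw [updateRow_apply]
      split_ifs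
      · rw [Pi.single_apply]
        split_ifs <;> simp <;> linarith
      · exact hentry i j
    have h1 := frobenius_norm_le _ (by positivity) hadj
    rw [hcard] at h1
    have hdet : ‖(toComplex X).det‖⁻¹ ≤ Real.exp t := by
      rw [← absDet_pow_eq, ← Real.exp_log hX0, ← Real.exp_nat_mul, ← Real.exp_neg,
        Real.exp_le_exp, ht, ← mul_neg]
      exact mul_le_mul_of_nonneg_left (neg_le_abs _) (by positivity)
    rw [inv_def, Ring.inverse_eq_inv', norm_smul, norm_inv]
    calc ‖(toComplex X).det‖⁻¹ * ‖(toComplex X).adjugate‖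
        ≤ Real.exp t * (D * (D.factorial * B ^ D)) := by gcongr
      _ = (D * D.factorial) * B ^ D * Real.exp t := by ring
      _ ≤ C * B ^ (D + 1) * Real.exp t := by
        have h3 : B ^ D ≤ B ^ (D + 1) := pow_le_pow_right₀ hB1 (by omega)
        have h4 : (D : ℝ) * D.factorial ≤ C := by linarith
        gcongr

theorem absDet_partialProduct (A : ℕ → Matrix (Fin N) (Fin N) 𝕂) (m : ℕ) :
    AbsDet.absDet (partialProduct A m) = ∏ i ∈ Finset.range m, AbsDet.absDet (A i) := by
  induction m with
  | zero => simp [partialProduct, absDet_one]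
  | succ m ih => rw [partialProduct, absDet_mul, ih, Finset.prod_range_succ, mul_comm]

theorem norm_toComplex_partialProduct_le {A : ℕ → Matrix (Fin N) (Fin N) 𝕂} {g : ℕ → ℝ}
    (h1 : ∀ i, ‖toComplex (A i)‖ ≤ Real.exp (g i))
    (h2 : ∀ i, ‖(toComplex (A i))⁻¹‖ ≤ Real.exp (g i)) (m : ℕ) :
    ‖toComplex (partialProduct A m)‖ ≤
        ‖(1 : Matrix (Fin N × Fin (d 𝕂)) (Fin N × Fin (d 𝕂)) ℂ)‖ *
          Real.exp (∑ i ∈ Finset.range m, g i) ∧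
      ‖(toComplex (partialProduct A m))⁻¹‖ ≤
        ‖(1 : Matrix (Fin N × Fin (d 𝕂)) (Fin N × Fin (d 𝕂)) ℂ)‖ *
          Real.exp (∑ i ∈ Finset.range m, g i) := by
  induction m with
  | zero => simp [partialProduct, toComplex_one]
  | succ m ih =>
    rw [partialProduct, toComplex_mul, Matrix.mul_inv_rev, Finset.sum_range_succ, Real.exp_add]
    constructor
    · refine (frobenius_norm_mul _ _).trans ?_
      rw [mul_comm, ← mul_assoc]
      exact mul_le_mul ih.1 (h1 m) (norm_nonneg _) (by positivity)
    · refine (frobenius_norm_mul _ _).trans ?_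
      rw [← mul_assoc]
      exact mul_le_mul ih.2 (h2 m) (norm_nonneg _) (by positivity)

theorem parallelotopeVolume_pow {k : ℕ} (Y : Matrix (Fin N) (Fin k) 𝕂) :
    parallelotopeVolume Y ^ (2 * d 𝕂) = ‖((toComplex Y)ᴴ * toComplex Y).det‖ := by
  rw [pow_mul, parallelotopeVolume, Real.sq_sqrt (absDet_nonneg _), absDet_pow_eq, toComplex_mul,
    toComplex_conjTranspose]

omit [NormedAlgebra ℝ 𝕂] [ComplexRep 𝕂] in
theorem parallelotopeVolume_nonneg {k : ℕ} (Y : Matrix (Fin N) (Fin k) 𝕂) :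
    0 ≤ parallelotopeVolume Y := Real.sqrt_nonneg _

theorem parallelotopeVolume_mul_square (P Y : Matrix (Fin N) (Fin N) 𝕂) :
    parallelotopeVolume (P * Y) = AbsDet.absDet P * AbsDet.absDet Y := by
  rw [parallelotopeVolume, absDet_mul, absDet_conjTranspose, absDet_mul]
  exact Real.sqrt_mul_self (mul_nonneg (absDet_nonneg _) (absDet_nonneg _))

omit [NormedAlgebra ℝ 𝕂] [ComplexRep 𝕂] in
theorem volumeGrowth_eq_of_pos {A : ℕ → Matrix (Fin N) (Fin N) 𝕂} {k : ℕ}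
    {Y : Matrix (Fin N) (Fin k) 𝕂} {m : ℕ}
    (h : 0 < parallelotopeVolume (partialProduct A m * Y)) :
    volumeGrowth A Y m =
      ((Real.log (parallelotopeVolume (partialProduct A m * Y)) / m : ℝ) : EReal) := by
  rw [volumeGrowth, ENNReal.log_ofReal_of_pos h, EReal.coe_div]
  rfl

/-- Volumes of dimension `k` grow at most at the rate of `k` times that of the norms; the volume of
`Y` only contributes a constant, so the bound is uniform in `Y`. -/
theorem limsup_volumeGrowth_le {A : ℕ → Matrix (Fin N) (Fin N) 𝕂} {g : ℕ → ℝ} {G : ℝ}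
    (h1 : ∀ i, ‖toComplex (A i)‖ ≤ Real.exp (g i))
    (h2 : ∀ i, ‖(toComplex (A i))⁻¹‖ ≤ Real.exp (g i))
    (hG : Tendsto (fun m : ℕ => (∑ i ∈ Finset.range m, g i) / m) atTop (𝓝 G))
    {k : ℕ} (Y : Matrix (Fin N) (Fin k) 𝕂) :
    limsup (volumeGrowth A Y) atTop ≤ ((k * G : ℝ) : EReal) := by
  have hd : (0 : ℝ) < d 𝕂 := by exact_mod_cast d_pos (𝕂 := 𝕂)
  set c₀ := ‖(1 : Matrix (Fin N × Fin (d 𝕂)) (Fin N × Fin (d 𝕂)) ℂ)‖ * ‖toComplex Y‖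
  set C : ℝ := (k * d 𝕂).factorial * (c₀ ^ 2) ^ (k * d 𝕂) + 1 with hC
  have hC0 : 0 < C := by positivity
  have hlim : Tendsto (fun m : ℕ => (((Real.log C / (2 * d 𝕂)) / m +
      k * ((∑ i ∈ Finset.range m, g i) / m) : ℝ) : EReal)) atTop (𝓝 ((k * G : ℝ) : EReal)) := by
    refine (continuous_coe_real_ereal.tendsto _).comp ?_
    have := (tendsto_const_div_atTop_nhds_zero_nat (Real.log C / (2 * d 𝕂))).add
      (hG.const_mul (k : ℝ))
    simpa using this
  rw [← hlim.limsup_eq]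
  refine limsup_le_limsup ?_
  filter_upwards [eventually_gt_atTop 0] with m hm
  have hm' : (0 : ℝ) < m := by exact_mod_cast hm
  set S := ∑ i ∈ Finset.range m, g i with hS
  rcases (parallelotopeVolume_nonneg (partialProduct A m * Y)).eq_or_lt with h0 | hpos
  · rw [volumeGrowth, ← h0, ENNReal.ofReal_zero, ENNReal.log_zero,
      EReal.bot_div_of_pos_ne_top (by exact_mod_cast hm') (by exact EReal.natCast_ne_top m)]
    exact bot_le
  · rw [volumeGrowth_eq_of_pos hpos]
    have hv := parallelotopeVolume_pow (partialProduct A m * Y)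
    have hle : parallelotopeVolume (partialProduct A m * Y) ^ (2 * d 𝕂) ≤
        C * Real.exp ((2 * d 𝕂 * k : ℕ) * S) := by
      rw [hv]
      refine (norm_det_gram_le _).trans ?_
      have hn : ‖toComplex (partialProduct A m * Y)‖ ≤ c₀ * Real.exp S := by
        rw [toComplex_mul]
        refine (frobenius_norm_mul _ _).trans ?_
        have := mul_le_mul_of_nonneg_right (norm_toComplex_partialProduct_le h1 h2 m).1
          (norm_nonneg (toComplex Y))
        refine this.trans (le_of_eq ?_)
        ring
      have hcard : Fintype.card (Fin k × Fin (d 𝕂)) = k * d 𝕂 := by simp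
      rw [hcard]
      calc ((k * d 𝕂).factorial : ℝ) * (‖toComplex (partialProduct A m * Y)‖ ^ 2) ^ (k * d 𝕂)
          ≤ (k * d 𝕂).factorial * ((c₀ * Real.exp S) ^ 2) ^ (k * d 𝕂) := by gcongr
        _ = (k * d 𝕂).factorial * (c₀ ^ 2) ^ (k * d 𝕂) * Real.exp ((2 * d 𝕂 * k : ℕ) * S) := by
          rw [Real.exp_nat_mul, mul_pow, mul_pow, ← pow_mul (Real.exp S) 2, mul_assoc]
          congr 3
          ring
        _ ≤ _ := by
          gcongr
          linarith
    have hlog := Real.log_le_log (by positivity) hle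
    rw [Real.log_pow, Real.log_mul hC0.ne' (Real.exp_pos _).ne', Real.log_exp] at hlog
    push_cast at hlog
    refine EReal.coe_le_coe_iff.2 ?_
    have h3 : Real.log (parallelotopeVolume (partialProduct A m * Y)) ≤
        Real.log C / (2 * d 𝕂) + k * S := by
      rw [← sub_le_iff_le_add, le_div_iff₀ (by positivity)]
      linarith
    calc _ ≤ (Real.log C / (2 * d 𝕂) + k * S) / m := by gcongr
      _ = _ := by ring

/-- The first `k` basis vectors span volumes which do not decay faster than exponentially. -/
theorem exists_le_limsup_volumeGrowth {A : ℕ → Matrix (Fin N) (Fin N) 𝕂} {g : ℕ → ℝ} {G : ℝ}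
    (h1 : ∀ i, ‖toComplex (A i)‖ ≤ Real.exp (g i))
    (h2 : ∀ i, ‖(toComplex (A i))⁻¹‖ ≤ Real.exp (g i))
    (hdet : ∀ i, AbsDet.absDet (A i) ≠ 0)
    (hG : Tendsto (fun m : ℕ => (∑ i ∈ Finset.range m, g i) / m) atTop (𝓝 G))
    {k : ℕ} (hk : k ≤ N) :
    ∃ Y : Matrix (Fin N) (Fin k) 𝕂, ColumnsIndependent Y ∧
      ((-(k * G) : ℝ) : EReal) ≤ limsup (volumeGrowth A Y) atTop := by
  have hd : (0 : ℝ) < d 𝕂 := by exact_mod_cast d_pos (𝕂 := 𝕂)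
  let Y : Matrix (Fin N) (Fin k) 𝕂 := (1 : Matrix (Fin N) (Fin N) 𝕂).submatrix id (Fin.castLE hk)
  let Z : Matrix (Fin k) (Fin N) 𝕂 := (1 : Matrix (Fin N) (Fin N) 𝕂).submatrix (Fin.castLE hk) id
  have hZY : Z * Y = 1 := by
    ext i j
    simp [Z, Y, mul_apply, one_apply]
  refine ⟨Y, fun c hc => ?_, ?_⟩
  · rw [← one_mulVec c, ← hZY, ← mulVec_mulVec, hc, mulVec_zero]
  set c₀ := ‖toComplex Z‖ * ‖(1 : Matrix (Fin N × Fin (d 𝕂)) (Fin N × Fin (d 𝕂)) ℂ)‖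
  set C : ℝ := (c₀ ^ 2) ^ (k * d 𝕂) + 1 with hC
  have hC0 : 0 < C := by positivity
  have hlim : Tendsto (fun m : ℕ => ((-((Real.log C / (2 * d 𝕂)) / m) -
      k * ((∑ i ∈ Finset.range m, g i) / m) : ℝ) : EReal)) atTop (𝓝 ((-(k * G) : ℝ) : EReal)) := by
    refine (continuous_coe_real_ereal.tendsto _).comp ?_
    have := (tendsto_const_div_atTop_nhds_zero_nat (Real.log C / (2 * d 𝕂))).neg.sub
      (hG.const_mul (k : ℝ))
    simpa using this
  rw [← hlim.limsup_eq]
  refine limsup_le_limsup ?_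
  filter_upwards [eventually_gt_atTop 0] with m hm
  have hm' : (0 : ℝ) < m := by exact_mod_cast hm
  set S := ∑ i ∈ Finset.range m, g i with hS
  have hP : IsUnit (toComplex (partialProduct A m)).det := by
    rw [isUnit_iff_ne_zero, ← norm_ne_zero_iff, ← absDet_pow_eq, absDet_partialProduct]
    exact pow_ne_zero _ (Finset.prod_ne_zero_iff.2 fun i _ => hdet i)
  have hQB : (toComplex Z * (toComplex (partialProduct A m))⁻¹) *
      toComplex (partialProduct A m * Y) = 1 := by
    rw [toComplex_mul, Matrix.mul_assoc, nonsing_inv_mul_cancel_left _ _ hP, ← toComplex_mul, hZY,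
      toComplex_one]
  have hge := one_le_norm_det_gram_mul hQB
  rw [← parallelotopeVolume_pow] at hge
  have hcard : Fintype.card (Fin k × Fin (d 𝕂)) = k * d 𝕂 := by simp
  rw [hcard] at hge
  have hn : ‖toComplex Z * (toComplex (partialProduct A m))⁻¹‖ ≤ c₀ * Real.exp S := by
    refine (frobenius_norm_mul _ _).trans ?_
    have := mul_le_mul_of_nonneg_left (norm_toComplex_partialProduct_le h1 h2 m).2
      (norm_nonneg (toComplex Z))
    refine this.trans (le_of_eq ?_)
    ring
  have hle : (1 : ℝ) ≤ parallelotopeVolume (partialProduct A m * Y) ^ (2 * d 𝕂) *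
      (C * Real.exp ((2 * d 𝕂 * k : ℕ) * S)) := by
    refine hge.trans (mul_le_mul_of_nonneg_left ?_ (pow_nonneg (parallelotopeVolume_nonneg _) _))
    calc (‖toComplex Z * (toComplex (partialProduct A m))⁻¹‖ ^ 2) ^ (k * d 𝕂)
        ≤ ((c₀ * Real.exp S) ^ 2) ^ (k * d 𝕂) := by gcongr
      _ = (c₀ ^ 2) ^ (k * d 𝕂) * Real.exp ((2 * d 𝕂 * k : ℕ) * S) := by
        rw [Real.exp_nat_mul, mul_pow, mul_pow, ← pow_mul (Real.exp S) 2]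
        congr 2
        ring
      _ ≤ _ := by
        gcongr
        linarith
  have hpos : 0 < parallelotopeVolume (partialProduct A m * Y) := by
    refine (parallelotopeVolume_nonneg _).lt_of_ne' fun h0 => ?_
    rw [h0, zero_pow (by have := d_pos (𝕂 := 𝕂); omega), zero_mul] at hle
    linarith
  rw [volumeGrowth_eq_of_pos hpos]
  have hlog := Real.log_le_log one_pos hle
  rw [Real.log_one, Real.log_mul (by positivity) (by positivity), Real.log_pow,
    Real.log_mul hC0.ne' (Real.exp_pos _).ne', Real.log_exp] at hlog
  push_cast at hlog
  refine EReal.coe_le_coe_iff.2 ?_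
  have h3 : -(Real.log C / (2 * d 𝕂)) - k * S ≤
      Real.log (parallelotopeVolume (partialProduct A m * Y)) := by
    rw [sub_le_iff_le_add, neg_le_iff_add_nonneg', ← sub_neg_eq_add, sub_nonneg,
      le_div_iff₀ (by positivity)]
    linarith
  calc _ = (-(Real.log C / (2 * d 𝕂)) - k * S) / m := by ring
    _ ≤ _ := by gcongr

theorem tendsto_volumeGrowth {A : ℕ → Matrix (Fin N) (Fin N) 𝕂} [FiniteDimensional ℝ 𝕂]
    (hdet : ∀ i, AbsDet.absDet (A i) ≠ 0) {c : ℝ}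
    (hc : Tendsto (fun m : ℕ => (∑ i ∈ Finset.range m, Real.log (AbsDet.absDet (A i))) / m)
      atTop (𝓝 c)) {Y : Matrix (Fin N) (Fin N) 𝕂} (hY : ColumnsIndependent Y) :
    Tendsto (volumeGrowth A Y) atTop (𝓝 (c : EReal)) := by
  have hY0 : AbsDet.absDet Y ≠ 0 := absDet_ne_zero_of_columnsIndependent hY
  have hP0 : ∀ m, AbsDet.absDet (partialProduct A m) ≠ 0 := fun m => by
    rw [absDet_partialProduct]
    exact Finset.prod_ne_zero_iff.2 fun i _ => hdet i
  have hlim : Tendsto (fun m : ℕ => (((∑ i ∈ Finset.range m, Real.log (AbsDet.absDet (A i))) / m +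
      Real.log (AbsDet.absDet Y) / m : ℝ) : EReal)) atTop (𝓝 (c : EReal)) := by
    refine (continuous_coe_real_ereal.tendsto _).comp ?_
    simpa using hc.add (tendsto_const_div_atTop_nhds_zero_nat (Real.log (AbsDet.absDet Y)))
  refine hlim.congr fun m => ?_
  have hpos : 0 < parallelotopeVolume (partialProduct A m * Y) := by
    refine (parallelotopeVolume_nonneg _).lt_of_ne' ?_
    rw [parallelotopeVolume_mul_square]
    exact mul_ne_zero (hP0 m) hY0
  rw [volumeGrowth_eq_of_pos hpos, parallelotopeVolume_mul_square, Real.log_mul (hP0 m) hY0,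
    absDet_partialProduct, Real.log_prod fun i _ => hdet i, add_div]

/-- The sums of the first `k` exponents are between `-k G` and `k G`, hence finite, and their
differences telescope to the sum for `k = N`, which is a limit. -/
theorem exists_lyapunovExponents {A : ℕ → Matrix (Fin N) (Fin N) 𝕂} [FiniteDimensional ℝ 𝕂]
    (hdet : ∀ i, AbsDet.absDet (A i) ≠ 0) {c G : ℝ}
    (hc : Tendsto (fun m : ℕ => (∑ i ∈ Finset.range m, Real.log (AbsDet.absDet (A i))) / m)
      atTop (𝓝 c))
    (hG : Tendsto (fun m : ℕ => (∑ i ∈ Finset.range m, logNormBound (A i)) / m) atTop (𝓝 G)) :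
    ∃ lyap : Fin N → ℝ, (∀ k, lyapunovExponent A k = (lyap k : EReal)) ∧ ∑ k, lyap k = c := by
  have h1 := fun i => (norm_toComplex_le_exp_logNormBound (hdet i)).1
  have h2 := fun i => (norm_toComplex_le_exp_logNormBound (hdet i)).2
  have hub : ∀ k : ℕ, lyapunovSum A k ≤ ((k * G : ℝ) : EReal) := fun k =>
    iSup₂_le fun Y _ => limsup_volumeGrowth_le h1 h2 hG Y
  have hlb : ∀ k : ℕ, k ≤ N → ((-(k * G) : ℝ) : EReal) ≤ lyapunovSum A k := by
    intro k hk
    obtain ⟨Y, hY, hle⟩ := exists_le_limsup_volumeGrowth h1 h2 hdet hG hk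
    exact hle.trans (le_iSup₂ (f := fun (Y : Matrix (Fin N) (Fin k) 𝕂)
      (_ : ColumnsIndependent Y) => limsup (volumeGrowth A Y) atTop) Y hY)
  have hreal : ∀ k : ℕ, k ≤ N → ((lyapunovSum A k).toReal : EReal) = lyapunovSum A k := by
    intro k hk
    refine EReal.coe_toReal ?_ ?_
    · exact ((hub k).trans_lt (EReal.coe_lt_top _)).ne
    · exact ((EReal.bot_lt_coe _).trans_le (hlb k hk)).ne'
  have h0 : lyapunovSum A 0 = 0 := by
    refine le_antisymm ?_ ?_
    · simpa using hub 0
    · simpa using hlb 0 (Nat.zero_le N)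
  have hN : lyapunovSum A N = (c : EReal) := by
    have hone : ColumnsIndependent (1 : Matrix (Fin N) (Fin N) 𝕂) := fun v hv => by
      rwa [one_mulVec] at hv
    refine le_antisymm (iSup₂_le fun Y hY => (tendsto_volumeGrowth hdet hc hY).limsup_eq.le) ?_
    rw [← (tendsto_volumeGrowth hdet hc hone).limsup_eq]
    exact le_iSup₂ (f := fun (Y : Matrix (Fin N) (Fin N) 𝕂)
      (_ : ColumnsIndependent Y) => limsup (volumeGrowth A Y) atTop) 1 hone
  refine ⟨fun k => (lyapunovSum A (k + 1)).toReal - (lyapunovSum A k).toReal, fun k => ?_, ?_⟩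
  · rw [lyapunovExponent, EReal.coe_sub, hreal _ k.2, hreal _ k.2.le]
  · rw [Fin.sum_univ_eq_sum_range
      (fun k => (lyapunovSum A (k + 1)).toReal - (lyapunovSum A k).toReal) N,
      Finset.sum_range_sub (fun k => (lyapunovSum A k).toReal), h0, hN]
    simp

end Volumes

end Bounds

section Ensembles

open ComplexRep Matrix

/-! ### The law of large numbers for products of random matrices -/

theorem ae_tendsto_average {S Ω : Type*} [MeasurableSpace S] [MeasurableSpace Ω] {P : Measure Ω}
    {μ : Measure S} {X : ℕ → Ω → S} (hX : ∀ i, HasLaw (X i) μ P) (hind : iIndepFun X P)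
    {g : S → ℝ} (hg : Measurable g) (hint : Integrable g μ) :
    ∀ᵐ ω ∂P, Tendsto (fun m : ℕ => (∑ i ∈ Finset.range m, g (X i ω)) / m) atTop
      (𝓝 (∫ x, g x ∂μ)) := by
  have hint' : Integrable (g ∘ X 0) P := by
    rw [← (hX 0).map_eq] at hint
    exact hint.comp_aemeasurable (hX 0).aemeasurable
  have h := strong_law_ae (μ := P) (fun i => g ∘ X i) hint'
    (fun i j hij => ((hind.indepFun hij).comp hg hg))
    (fun i => IdentDistrib.comp ⟨(hX i).aemeasurable, (hX 0).aemeasurable,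
      (hX i).map_eq.trans (hX 0).map_eq.symm⟩ hg)
  filter_upwards [h] with ω hω
  rw [(hX 0).integral_comp hint.aestronglyMeasurable] at hω
  refine hω.congr fun m => ?_
  rw [smul_eq_mul, div_eq_inv_mul]
  rfl

section RadialRows

variable {𝕂 : Type} [NormedRing 𝕂] [StarRing 𝕂] [NormedAlgebra ℝ 𝕂] [AbsDet 𝕂] [ComplexRep 𝕂]
  [FiniteDimensional ℝ 𝕂] [MeasureSpace 𝕂] [BorelSpace 𝕂] {N : ℕ}

theorem measurable_logNormBound :
    Measurable (logNormBound : Matrix (Fin N) (Fin N) 𝕂 → ℝ) := by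
  have h1 := measurable_absDet (𝕂 := 𝕂) (n := N)
  have h2 : ∀ l : Fin N, Measurable fun X : Matrix (Fin N) (Fin N) 𝕂 => rowNormSq (X l) :=
    fun l => measurable_rowNormSq.comp (measurable_pi_apply (X := fun _ : Fin N => Fin N → 𝕂) l)
  unfold logNormBound
  have h3 : Measurable fun X : Matrix (Fin N) (Fin N) 𝕂 => |Real.log (AbsDet.absDet X)| :=
    h1.log.abs
  fun_prop

variable [StarModule ℝ 𝕂] [NormOneClass 𝕂] [Nontrivial 𝕂]
  [(volume : Measure 𝕂).IsAddHaarMeasure] [GaussianVolume 𝕂]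

/-- The formula for the logarithmic mean and for the sum of the Lyapunov exponents, for rows with
radial densities. -/
theorem logDetFormula_of_radialProfile {f : Fin N → (Fin N → 𝕂) → ℝ}
    {F : Fin N → ℝ → ENNReal} {ψ : Fin N → ℝ → ℝ} {c : Fin N → ℝ}
    (hF : ∀ l, RadialProfile ((Module.finrank ℝ 𝕂 : ℝ) * N / 2) (F l) (ψ l) (c l))
    (hf : ∀ l x, ENNReal.ofReal (f l x) = F l (rowNormSq x)) {v : ℝ}
    (hv : v = 1 / 2 * ∑ l : Fin N,
      (digamma ((Module.finrank ℝ 𝕂 : ℝ) * ((N : ℝ) - (l : ℕ)) / 2) + c l)) :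
    LogDetFormula.{u} f v := by
  let μ : Fin N → Measure (Fin N → 𝕂) := fun l =>
    (volume : Measure (Fin N → 𝕂)).withDensity fun x => ENNReal.ofReal (f l x)
  have hμ : ∀ l, μ l = (volume : Measure (Fin N → 𝕂)).withDensity fun x => F l (rowNormSq x) := by
    intro l
    simp only [μ, hf]
  obtain ⟨hprob, hrow, hpos, hint, hmean⟩ := mean_log_absDet hF hμ
  have hof : Measurable (Matrix.of : (Fin N → Fin N → 𝕂) → Matrix (Fin N) (Fin N) 𝕂) :=
    measurable_id
  have hens : rowEnsemble f = (Measure.pi μ).map Matrix.of := rfl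
  have hlogm : Measurable fun X : Matrix (Fin N) (Fin N) 𝕂 => Real.log (AbsDet.absDet X) :=
    measurable_absDet.log
  have hI : Integrable (fun X => Real.log (AbsDet.absDet X)) (rowEnsemble f) := by
    rw [hens, integrable_map_measure hlogm.aestronglyMeasurable hof.aemeasurable]
    exact hint
  have hM : ∫ X, Real.log (AbsDet.absDet X) ∂rowEnsemble f = v := by
    rw [hens, integral_map hof.aemeasurable hlogm.aestronglyMeasurable, hv]
    exact hmean
  refine ⟨⟨hI, hM⟩, ?_⟩
  have hpos' : ∀ᵐ X ∂rowEnsemble f, AbsDet.absDet X ≠ 0 := by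
    rw [hens]
    exact (ae_map_iff (p := fun X => AbsDet.absDet X ≠ 0) hof.aemeasurable
      (measurable_absDet (measurableSet_singleton 0)).compl).2 (hpos.mono fun X hX => hX.ne')
  have hbound : Integrable logNormBound (rowEnsemble f) := by
    have hlog : ∀ l, Integrable (fun x => Real.log (1 + rowNormSq x)) (μ l) := by
      intro l
      have := hprob l
      -- `log (1 + t) ≤ log 2 + |log t|`
      refine Integrable.mono' ((integrable_const (Real.log 2)).add (hrow l).abs)
        (by fun_prop : Measurable _).aestronglyMeasurable (ae_of_all _ fun x => ?_)
      have h0 := rowNormSq_nonneg x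
      rw [Real.norm_of_nonneg (Real.log_nonneg (by linarith)), Pi.add_apply]
      rcases le_total (rowNormSq x) 1 with h1 | h1
      · have := Real.log_le_log (by linarith) (by linarith : 1 + rowNormSq x ≤ 2)
        linarith [abs_nonneg (Real.log (rowNormSq x))]
      · have := Real.log_le_log (by linarith) (by linarith : 1 + rowNormSq x ≤ 2 * rowNormSq x)
        rw [Real.log_mul two_ne_zero (by linarith)] at this
        linarith [le_abs_self (Real.log (rowNormSq x))]
    have hlog' : ∀ l, Integrable (fun X : Matrix (Fin N) (Fin N) 𝕂 =>
        Real.log (1 + rowNormSq (X l))) (rowEnsemble f) := by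
      intro l
      rw [hens, integrable_map_measure _ hof.aemeasurable]
      · exact (measurePreserving_eval μ l).integrable_comp_of_integrable (hlog l)
      · have h2 : Measurable fun X : Matrix (Fin N) (Fin N) 𝕂 => rowNormSq (X l) :=
          measurable_rowNormSq.comp (measurable_pi_apply (X := fun _ : Fin N => Fin N → 𝕂) l)
        exact (by fun_prop : Measurable _).aestronglyMeasurable
    have hP : IsProbabilityMeasure (rowEnsemble f) := by
      rw [hens]
      exact Measure.isProbabilityMeasure_map hof.aemeasurable
    unfold logNormBound
    exact ((integrable_const _).add
      (((integrable_finsetSum _ fun l _ => hlog' l).const_mul _).const_mul _)).add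
      (hI.abs.const_mul _)
  intro Ω _ P _ X hX hind
  have hne : ∀ᵐ ω ∂P, ∀ i, AbsDet.absDet (X i ω) ≠ 0 := by
    rw [ae_all_iff]
    intro i
    rw [← (hX i).map_eq] at hpos'
    exact ae_of_ae_map (hX i).aemeasurable hpos'
  filter_upwards [hne, ae_tendsto_average hX hind hlogm hI,
    ae_tendsto_average hX hind measurable_logNormBound hbound] with ω h1 h2 h3
  rw [hM] at h2
  exact ⟨exists_lyapunovExponents h1 h2 h3, fun Y hY => tendsto_volumeGrowth h1 h2 hY⟩

variable {β : ℕ}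

theorem logDetFormula_gaussian (hβ : Module.finrank ℝ 𝕂 = β) {σ : Fin N → ℝ} (hσ : ∀ l, 0 < σ l) :
    LogDetFormula.{u} (fun l (x : Fin N → 𝕂) => gaussianDensity β (σ l) x)
      (gaussianValue β σ) := by
  have hβ0 : (0 : ℝ) < Module.finrank ℝ 𝕂 := by exact_mod_cast Module.finrank_pos
  have hN : ∀ _ : Fin N, (0 : ℝ) < N := fun l => by exact_mod_cast Nat.zero_lt_of_lt l.2
  refine logDetFormula_of_radialProfile
    (fun l => radialProfile_gaussian (by have := hN l; positivity) (hσ l)) (fun l x => ?_) ?_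
  · rw [gaussianDensity, hβ]
  · rw [gaussianValue, hβ]
    congr 1
    exact Finset.sum_congr rfl fun l _ => add_comm _ _

theorem logDetFormula_betaI (hβ : Module.finrank ℝ 𝕂 = β) {ν : Fin N → ℝ} (hν : ∀ l, 0 < ν l) :
    LogDetFormula.{u} (fun l (x : Fin N → 𝕂) => betaIDensity β (ν l) x) (betaIValue β ν) := by
  have hβ0 : (0 : ℝ) < Module.finrank ℝ 𝕂 := by exact_mod_cast Module.finrank_pos
  have hN : ∀ _ : Fin N, (0 : ℝ) < N := fun l => by exact_mod_cast Nat.zero_lt_of_lt l.2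
  refine logDetFormula_of_radialProfile
    (fun l => radialProfile_betaI (b := (Module.finrank ℝ 𝕂 : ℝ) * ν l / 2)
      (by have := hN l; positivity) (by have := hν l; positivity)) (fun l x => ?_) ?_
  · rw [betaIDensity, hβ]
  · rw [betaIValue, hβ]
    congr 1
    refine Finset.sum_congr rfl fun l _ => ?_
    rw [sub_eq_add_neg, mul_add, add_div]

theorem logDetFormula_betaII (hβ : Module.finrank ℝ 𝕂 = β) {w : Fin N → ℝ} (hw : ∀ l, 0 < w l) :
    LogDetFormula.{u} (fun l (x : Fin N → 𝕂) => betaIIDensity β (w l) x) (betaIIValue β w) := by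
  have hβ0 : (0 : ℝ) < Module.finrank ℝ 𝕂 := by exact_mod_cast Module.finrank_pos
  have hN : ∀ _ : Fin N, (0 : ℝ) < N := fun l => by exact_mod_cast Nat.zero_lt_of_lt l.2
  refine logDetFormula_of_radialProfile
    (fun l => radialProfile_betaII (b := (Module.finrank ℝ 𝕂 : ℝ) * w l / 2)
      (by have := hN l; positivity) (by have := hw l; positivity)) (fun l x => ?_) ?_
  · rw [betaIIDensity, hβ, mul_add, add_div]
  · rw [betaIIValue, hβ]
    rfl

end RadialRows

/-! ### Real, complex and quaternion entries -/

theorem gaussianVolume_of_innerProductSpace {V : Type} [NormedAddCommGroup V]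
    [InnerProductSpace ℝ V] [FiniteDimensional ℝ V] [MeasurableSpace V] [BorelSpace V] :
    ∫⁻ v : V, ENNReal.ofReal (Real.exp (-‖v‖ ^ 2)) =
      ENNReal.ofReal (Real.pi ^ ((Module.finrank ℝ V : ℝ) / 2)) := by
  have h := GaussianFourier.integral_rexp_neg_mul_sq_norm (V := V) one_pos
  simp only [div_one, neg_mul, one_mul] at h
  have hne : ∫ v : V, Real.exp (-‖v‖ ^ 2) ≠ 0 := by
    rw [h]; exact (Real.rpow_pos_of_pos Real.pi_pos _).ne'
  rw [← h, ofReal_integral_eq_lintegral_ofReal (Integrable.of_integral_ne_zero hne)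
    (ae_of_all _ fun v => (Real.exp_pos _).le)]

theorem det_of_fin_one {n : ℕ} (X : Matrix (Fin n) (Fin n) ℂ) :
    (Matrix.of fun (p q : Fin n × Fin 1) => X p.1 q.1).det = X.det :=
  det_submatrix_equiv_self (Equiv.prodUnique (Fin n) (Fin 1)) X

instance : GaussianVolume ℝ := ⟨gaussianVolume_of_innerProductSpace⟩

instance : GaussianVolume ℂ := ⟨gaussianVolume_of_innerProductSpace⟩

instance : GaussianVolume ℍ[ℝ] := ⟨gaussianVolume_of_innerProductSpace⟩

noncomputable instance : ComplexRep ℝ where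
  d := 1
  d_pos := one_pos
  rho := (Matrix.scalar (Fin 1)).comp Complex.ofRealHom
  rho_star a := by
    ext i j
    fin_cases i; fin_cases j
    simp
  rho_continuous := by
    refine continuous_matrix fun i j => ?_
    fin_cases i; fin_cases j
    simpa using Complex.continuous_ofReal
  norm_rho_apply_le a i j := by
    fin_cases i; fin_cases j
    simp
  norm_det_rho a := by simp
  mul_star_self a := by simp [sq]
  absDet_nonneg X := abs_nonneg _
  absDet_pow {n} X := by
    have : (Matrix.of fun (p q : Fin n × Fin 1) =>
        ((Matrix.scalar (Fin 1)).comp Complex.ofRealHom) (X p.1 q.1) p.2 q.2) =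
        Matrix.of fun (p q : Fin n × Fin 1) => (X.map Complex.ofRealHom) p.1 q.1 := by
      ext p q
      simp [Subsingleton.elim p.2 q.2]
    rw [this, det_of_fin_one, pow_one]
    change |X.det| = ‖(Complex.ofRealHom.mapMatrix X).det‖
    rw [← RingHom.map_det]
    simp

noncomputable instance : ComplexRep ℂ where
  d := 1
  d_pos := one_pos
  rho := Matrix.scalar (Fin 1)
  rho_star a := by
    ext i j
    fin_cases i; fin_cases j
    simp
  rho_continuous := by
    refine continuous_matrix fun i j => ?_
    fin_cases i; fin_cases j
    simpa using continuous_id'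
  norm_rho_apply_le a i j := by
    fin_cases i; fin_cases j
    simp
  norm_det_rho a := by simp
  mul_star_self a := by
    have := Complex.mul_conj' a
    simpa using this
  absDet_nonneg X := norm_nonneg _
  absDet_pow {n} X := by
    have : (Matrix.of fun (p q : Fin n × Fin 1) => (Matrix.scalar (Fin 1)) (X p.1 q.1) p.2 q.2) =
        Matrix.of fun (p q : Fin n × Fin 1) => X p.1 q.1 := by
      ext p q
      simp [Subsingleton.elim p.2 q.2]
    rw [this, det_of_fin_one, pow_one]
    rfl

/-- The block of a quaternion, as a ring homomorphism. -/
noncomputable def quaternionBlockHom : ℍ[ℝ] →+* Matrix (Fin 2) (Fin 2) ℂ where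
  toFun := quaternionBlock
  map_one' := by
    ext i j
    fin_cases i <;> fin_cases j <;> simp [quaternionBlock, Complex.ext_iff]
  map_zero' := by
    ext i j
    fin_cases i <;> fin_cases j <;> simp [quaternionBlock, Complex.ext_iff]
  map_add' a b := by
    ext i j
    fin_cases i <;> fin_cases j <;> simp [quaternionBlock, Complex.ext_iff] <;> ring
  map_mul' a b := by
    ext i j
    fin_cases i <;> fin_cases j <;>
      simp [quaternionBlock, Complex.ext_iff, mul_apply, Fin.sum_univ_two] <;> constructor <;> ring

theorem norm_sq_quaternion (a : ℍ[ℝ]) :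
    ‖a‖ ^ 2 = a.re ^ 2 + a.imI ^ 2 + a.imJ ^ 2 + a.imK ^ 2 := by
  rw [sq, ← Quaternion.normSq_eq_norm_mul_self, Quaternion.normSq_def']

instance : StarModule ℝ ℍ[ℝ] where
  star_smul r a := by ext <;> simp

noncomputable instance : ComplexRep ℍ[ℝ] where
  d := 2
  d_pos := two_pos
  rho := quaternionBlockHom
  rho_star a := by
    ext i j
    fin_cases i <;> fin_cases j <;>
      simp [quaternionBlockHom, quaternionBlock, Complex.ext_iff]
  rho_continuous := by
    have h : Continuous fun z : ℝ × ℝ => (⟨z.1, z.2⟩ : ℂ) :=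
      Complex.equivRealProdCLM.symm.continuous
    have h1 : Continuous fun a : ℍ[ℝ] => (⟨a.re, a.imI⟩ : ℂ) :=
      h.comp (Quaternion.continuous_re.prodMk Quaternion.continuous_imI)
    have h2 : Continuous fun a : ℍ[ℝ] => (⟨a.imJ, a.imK⟩ : ℂ) :=
      h.comp (Quaternion.continuous_imJ.prodMk Quaternion.continuous_imK)
    refine continuous_matrix fun i j => ?_
    fin_cases i <;> fin_cases j
    · exact h1
    · exact h2
    · exact h2.star.neg
    · exact h1.star
  norm_rho_apply_le a i j := by
    refine le_of_sq_le_sq ?_ (norm_nonneg _)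
    rw [norm_sq_quaternion, ← Complex.normSq_eq_norm_sq]
    fin_cases i <;> fin_cases j <;>
      simp [quaternionBlockHom, quaternionBlock, Complex.normSq_apply] <;>
      nlinarith [sq_nonneg a.re, sq_nonneg a.imI, sq_nonneg a.imJ, sq_nonneg a.imK]
  norm_det_rho a := by
    have : (quaternionBlockHom a).det = ((‖a‖ ^ 2 : ℝ) : ℂ) := by
      rw [norm_sq_quaternion, det_fin_two]
      simp [quaternionBlockHom, quaternionBlock, Complex.ext_iff, sq]
      constructor <;> ring
    rw [this, Complex.norm_real, Real.norm_of_nonneg (by positivity)]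
  mul_star_self a := by
    rw [Quaternion.self_mul_star, Quaternion.normSq_eq_norm_mul_self, ← sq]
    rfl
  absDet_nonneg X := Real.sqrt_nonneg _
  absDet_pow X := Real.sq_sqrt (norm_nonneg _)

end Ensembles

end IsotropicEnsembles

theorem corollaryC4 (N : ℕ) :
    (∀ σ : Fin N → ℝ, (∀ l, 0 < σ l) →
      LogDetFormula.{u} (fun l (x : Fin N → ℝ) => gaussianDensity 1 (σ l) x) (gaussianValue 1 σ) ∧
      LogDetFormula.{u} (fun l (x : Fin N → ℂ) => gaussianDensity 2 (σ l) x) (gaussianValue 2 σ) ∧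
      LogDetFormula.{u} (fun l (x : Fin N → ℍ[ℝ]) => gaussianDensity 4 (σ l) x)
        (gaussianValue 4 σ)) ∧
    (∀ ν : Fin N → ℝ, (∀ l, 0 < ν l) →
      LogDetFormula.{u} (fun l (x : Fin N → ℝ) => betaIDensity 1 (ν l) x) (betaIValue 1 ν) ∧
      LogDetFormula.{u} (fun l (x : Fin N → ℂ) => betaIDensity 2 (ν l) x) (betaIValue 2 ν) ∧
      LogDetFormula.{u} (fun l (x : Fin N → ℍ[ℝ]) => betaIDensity 4 (ν l) x)
        (betaIValue 4 ν)) ∧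
    (∀ ω : Fin N → ℝ, (∀ l, 0 < ω l) →
      LogDetFormula.{u} (fun l (x : Fin N → ℝ) => betaIIDensity 1 (ω l) x) (betaIIValue 1 ω) ∧
      LogDetFormula.{u} (fun l (x : Fin N → ℂ) => betaIIDensity 2 (ω l) x) (betaIIValue 2 ω) ∧
      LogDetFormula.{u} (fun l (x : Fin N → ℍ[ℝ]) => betaIIDensity 4 (ω l) x)
        (betaIIValue 4 ω)) := by
  refine ⟨fun σ hσ => ⟨?_, ?_, ?_⟩, fun ν hν => ⟨?_, ?_, ?_⟩, fun ω hω => ⟨?_, ?_, ?_⟩⟩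
  · exact logDetFormula_gaussian (by simp) hσ
  · exact logDetFormula_gaussian Complex.finrank_real_complex hσ
  · exact logDetFormula_gaussian Quaternion.finrank_eq_four hσ
  · exact logDetFormula_betaI (by simp) hν
  · exact logDetFormula_betaI Complex.finrank_real_complex hν
  · exact logDetFormula_betaI Quaternion.finrank_eq_four hν
  · exact logDetFormula_betaII (by simp) hω
  · exact logDetFormula_betaII Complex.finrank_real_complex hω
  · exact logDetFormula_betaII Quaternion.finrank_eq_four hω
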